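/- Let $M^m$ be a smooth $m$-manifold and let $f\colon M^m\to\mathbb R^{m+1}$ be a wave front, i.e. a $C^\infty$ map such that every point has a neighbourhood carrying a smooth unit normal vector field $\nu$ along $f$ (so $|\nu|=1$ and $\langle df(X),\nu\rangle=0$ for all tangent vectors $X$) for which $(f,\nu)$ is an immersion into the unit tangent bundle $\mathbb R^{m+1}\times S^m$. Let $\Sigma_f$ be the set of points where $df$ is not injective. In local coordinates $(u_1,\dots,u_m)$ put $\lambda=\det(f_{u_1},\dots,f_{u_m},\nu)$, so that locally $\Sigma_f=\{\lambda=0\}$. A point $p\in\Sigma_f$ is an $A_2$-point if $d\lambda_p\neq0$ (so that $\Sigma_f$ is a smooth hypersurface near $p$ with $T_p\Sigma_f=\ker d\lambda_p$, and $\ker df_p$ is a line) and $\ker df_p$ is transversal to $T_p\Sigma_f$. The second fundamental form is $II(X,Y)=-\langle df(X),d\nu(Y)\rangle$ (well defined up to sign near an $A_2$-point). Near an $A_2$-point $p$ take smooth vector fields $e_1,\dots,e_{m-1}$, orthonormal for $ds^2=\langle df,df\rangle$ and tangent to $\Sigma_f$ along $\Sigma_f$, and let $\mathbf n$ be the smooth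 unit vector field along $f$ such that $(df(e_1),\dots,df(e_{m-1}),\mathbf n)$ is an orthonormal frame of $\nu^\perp$ with $\det(df(e_1),\dots,df(e_{m-1}),\mathbf n,\nu)>0$. Let $\eta\in\ker df_p$ be such that $(e_1,\dots,e_{m-1},\eta)$ is positively oriented in the coordinates $(u_1,\dots,u_m)$. The singular shape operator $S\colon T_p\Sigma_f\to T_p\Sigma_f$ is given by $$df(S(X))=-\operatorname{sgn}\bigl(d\lambda(\eta)\bigr)\,D_X\mathbf n ,$$ where $D_X\mathbf n$ is the component orthogonal to $\nu$ of the derivative of $\mathbf n$ in the direction $X$; $S$ does not depend on the choices made. The singular principal curvatures of $f$ at $p$ are the eigenvalues of $S$. Let $U\subset M^m$ be an open set such that every point of $U\cap\Sigma_f$ is an $A_2$-point, and let $K$ be the sectional curvature of the induced metric $ds^2$ on $U\setminus\Sigma_f$. Then: 1. If $K$ is bounded on $U\setminus\Sigma_f$ (there is a constant $C$ with $|K|\le C$ for all tangent planes at all points of $U\setminus\Sigma_f$), then $II$ vanishes at every point of $U\cap\Sigma_f$. 2. If $K\ge 0$ on $U\setminus\Sigma_f$ (for all tangent planes), then $K$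 is locally bounded, i.e. each point $p\in U$ has a neighbourhood $V$ such that $K$ is bounded on $(V\cap U)\setminus\Sigma_f$, and all singular principal curvatures of $f$ at the points of $U\cap\Sigma_f$ are non-positive. -/

import Mathlib

open Set Filter Topology Manifold
open scoped ContDiff Manifold

noncomputable section

namespace WaveFront

/-- Euclidean space `ℝⁿ`. -/
abbrev Euc (n : ℕ) : Type := EuclideanSpace ℝ (Fin n)

/-! ### Riemannian curvature in coordinates

`g` is the matrix of a metric on (an open subset of) `ℝᵐ`. -/

section Coordinates

variable {m : ℕ}

/-- The `i`-th partial derivative of a function of `m` variables. -/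
def pd {E : Type*} [NormedAddCommGroup E] [NormedSpace ℝ E]
    (i : Fin m) (h : Euc m → E) (u : Euc m) : E :=
  fderiv ℝ h u (EuclideanSpace.single i 1)

/-- The Christoffel symbol `Γᵏᵢⱼ` of the Levi-Civita connection of `g`. -/
def christoffel (g : Euc m → Matrix (Fin m) (Fin m) ℝ) (k i j : Fin m) (u : Euc m) : ℝ :=
  (1 / 2) * ∑ l, (g u)⁻¹ k l *
    (pd i (fun v => g v j l) u + pd j (fun v => g v i l) u - pd l (fun v => g v i j) u)

/-- The component `Rˡₖᵢⱼ` of the curvature tensor, where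
`R(X, Y) Z = ∇_X ∇_Y Z - ∇_Y ∇_X Z - ∇_[X,Y] Z` and `R(∂ᵢ, ∂ⱼ) ∂ₖ = ∑ₗ Rˡₖᵢⱼ ∂ₗ`. -/
def riemann (g : Euc m → Matrix (Fin m) (Fin m) ℝ) (l k i j : Fin m) (u : Euc m) : ℝ :=
  pd i (christoffel g l j k) u - pd j (christoffel g l i k) u
    + ∑ s, (christoffel g s j k u * christoffel g l i s u
        - christoffel g s i k u * christoffel g l j s u)

/-- The value `g(X, Y)` at `u`. -/
def metricApply (g : Euc m → Matrix (Fin m) (Fin m) ℝ) (u X Y : Euc m) : ℝ :=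
  ∑ i, ∑ j, g u i j * X i * Y j

/-- The sectional curvature at `u` of the plane spanned by `X` and `Y`:
`g(R(X, Y) Y, X) / (g(X, X) g(Y, Y) - g(X, Y)²)`. -/
def sectional (g : Euc m → Matrix (Fin m) (Fin m) ℝ) (u X Y : Euc m) : ℝ :=
  (∑ i, ∑ j, ∑ k, ∑ l, ∑ s, g u l s * riemann g l k i j u * X i * Y j * Y k * X s) /
    (metricApply g u X X * metricApply g u Y Y - metricApply g u X Y ^ 2)

/-- The matrix of the first fundamental form of a map `F` from `ℝᵐ` to `ℝᵐ⁺¹`. -/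
def firstFormMatrix (F : Euc m → Euc (m + 1)) (u : Euc m) : Matrix (Fin m) (Fin m) ℝ :=
  Matrix.of fun i j => inner ℝ (pd i F u) (pd j F u)

/-- The determinant of `n` vectors of `ℝⁿ`. -/
def vecDet {n : ℕ} (v : Fin n → Euc n) : ℝ :=
  Matrix.det (Matrix.of fun i j => v i j)

/-- The volume form `μ(v₁, …, vₘ) = det(v₁, …, vₘ, ν)` on the hyperplane `ν^⊥` that corresponds
to the co-orientation given by the unit vector `ν`. -/
def coorientForm (ν : Euc (m + 1)) (v : Fin m → Euc (m + 1)) : ℝ :=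
  vecDet (Fin.snoc (α := fun _ => Euc (m + 1)) v ν)

/-- The `m`-tuple `(e₁, …, eₘ₋₁, x)`. -/
def snocFrame {V : Type*} (e : Fin (m - 1) → V) (x : V) : Fin m → V :=
  fun i => if h : (i : ℕ) < m - 1 then e ⟨i, h⟩ else x

/-- The signed Jacobian function `λ = μ(∂₁F, …, ∂ₘF)`, where `N` is a unit normal along `F`. -/
def jacobian (F N : Euc m → Euc (m + 1)) (u : Euc m) : ℝ :=
  coorientForm (N u) fun j => pd j F u

/-- The tangent space at a non-degenerate singular point `u` of the singular set `{λ = 0}`. -/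
def singularTangent (F N : Euc m → Euc (m + 1)) (u : Euc m) : Submodule ℝ (Euc m) :=
  LinearMap.ker (fderiv ℝ (jacobian F N) u : Euc m →ₗ[ℝ] ℝ)

/-- `e₁, …, eₘ₋₁` are smooth vector fields on `W`, orthonormal for the first fundamental form and
tangent to the singular set along the singular set, and `n` is the conormal vector field: the
smooth section over `W` of the bundle `N^⊥` for which `(dF(e₁), …, dF(eₘ₋₁), n)` is a positively
oriented orthonormal frame of that bundle. -/
structure IsConormalFrame (F N : Euc m → Euc (m + 1)) (W : Set (Euc m))
    (e : Fin (m - 1) → Euc m → Euc m) (n : Euc m → Euc (m + 1)) : Prop where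
  smooth_e : ∀ i, ContDiffOn ℝ ∞ (e i) W
  smooth_n : ContDiffOn ℝ ∞ n W
  tangent_e : ∀ i, ∀ u ∈ W, jacobian F N u = 0 → e i u ∈ singularTangent F N u
  orthonormal_e : ∀ u ∈ W, Orthonormal ℝ fun i => fderiv ℝ F u (e i u)
  norm_n : ∀ u ∈ W, ‖n u‖ = 1
  inner_n_normal : ∀ u ∈ W, inner ℝ (n u) (N u) = 0
  inner_n_e : ∀ u ∈ W, ∀ i, inner ℝ (n u) (fderiv ℝ F u (e i u)) = 0
  positive : ∀ u ∈ W,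
    0 < coorientForm (N u) (snocFrame (fun i => fderiv ℝ F u (e i u)) (n u))

/-- The connection of the bundle `N^⊥`: the derivative of the section `n` in the direction `X`,
projected orthogonally to `N^⊥`. -/
def tangentialDeriv (N n : Euc m → Euc (m + 1)) (u X : Euc m) : Euc (m + 1) :=
  fderiv ℝ n u X - inner ℝ (fderiv ℝ n u X) (N u) • N u

/-- `S` is the singular shape operator at `u` of the map `F` with unit normal `N` on the open
neighbourhood `W` of `u`: the endomorphism of the tangent space of the singular set with
`dF(S X) = - sgn(dλ(η)) D_X n`, where `η` is a null vector for which `(e₁, …, eₘ₋₁, η)` is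
positively oriented. -/
def IsSingularShapeOperator (F N : Euc m → Euc (m + 1)) (W : Set (Euc m)) (u : Euc m)
    (S : Module.End ℝ (singularTangent F N u)) : Prop :=
  ∃ (e : Fin (m - 1) → Euc m → Euc m) (n : Euc m → Euc (m + 1)) (η : Euc m),
    IsConormalFrame F N W e n ∧
    fderiv ℝ F u η = 0 ∧
    0 < vecDet (snocFrame (fun i => e i u) η) ∧
    ∀ X : singularTangent F N u,
      fderiv ℝ F u (S X : Euc m) =
        -(Real.sign (fderiv ℝ (jacobian F N) u η) • tangentialDeriv N n u (X : Euc m))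

end Coordinates

/-! ### Wave fronts on manifolds

The tangent space of `M` at `p` is, by definition, the space of coordinate vectors in the
preferred chart at `p`; the coordinate notions above are applied in that chart. -/

section Manifolds

variable {m : ℕ} {M : Type*} [TopologicalSpace M] [ChartedSpace (Euc m) M]

/-- A map `h` on `M` read in the preferred chart at `p`. -/
def chartRep (h : M → Euc (m + 1)) (p : M) : Euc m → Euc (m + 1) :=
  h ∘ (extChartAt (𝓡 m) p).symm

/-- The coordinates of `p` in the preferred chart at `p`. -/
def coordAt (p : M) : Euc m := extChartAt (𝓡 m) p p

/-- The differential at `p` of a map from `M` to `ℝᵐ⁺¹`. -/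
def differential (h : M → Euc (m + 1)) (p : M) : TangentSpace (𝓡 m) p →L[ℝ] Euc (m + 1) :=
  mfderiv (𝓡 m) 𝓘(ℝ, Euc (m + 1)) h p

/-- `ν` is a smooth unit normal vector field along `f` on `V`. -/
structure IsUnitNormalOn (f ν : M → Euc (m + 1)) (V : Set M) : Prop where
  smooth : ContMDiffOn (𝓡 m) 𝓘(ℝ, Euc (m + 1)) ∞ ν V
  norm_eq : ∀ q ∈ V, ‖ν q‖ = 1
  normal : ∀ q ∈ V, ∀ X : TangentSpace (𝓡 m) q, inner ℝ (differential f q X) (ν q) = 0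

/-- `f` is a wave front: a smooth map which locally has a smooth unit normal vector field `ν` such
that `(f, ν)`, as a map to the unit tangent bundle `ℝᵐ⁺¹ × Sᵐ`, is an immersion. -/
def IsWaveFront (f : M → Euc (m + 1)) : Prop :=
  ContMDiff (𝓡 m) 𝓘(ℝ, Euc (m + 1)) ∞ f ∧
    ∀ p : M, ∃ (V : Set M) (ν : M → Euc (m + 1)), IsOpen V ∧ p ∈ V ∧ IsUnitNormalOn f ν V ∧
      ∀ q ∈ V, Function.Injective
        (mfderiv (𝓡 m) 𝓘(ℝ, Euc (m + 1) × Euc (m + 1)) (fun x => (f x, ν x)) q)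

/-- The singular set of `f`: the points where `f` is not an immersion. -/
def singularSet (f : M → Euc (m + 1)) : Set M :=
  {p | ¬ Function.Injective (differential f p)}

/-- `p` is an `A₂`-point of `f`: a singular point which is non-degenerate (`dλ ≠ 0`) and at which
the null direction is transversal to the singular submanifold. -/
def IsA2Point (f : M → Euc (m + 1)) (p : M) : Prop :=
  p ∈ singularSet f ∧
    ∃ (V : Set M) (ν : M → Euc (m + 1)), IsOpen V ∧ p ∈ V ∧ IsUnitNormalOn f ν V ∧
      fderiv ℝ (jacobian (chartRep f p) (chartRep ν p)) (coordAt p) ≠ 0 ∧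
      LinearMap.ker (fderiv ℝ (chartRep f p) (coordAt p) : Euc m →ₗ[ℝ] Euc (m + 1)) ⊔
        singularTangent (chartRep f p) (chartRep ν p) (coordAt p) = ⊤

/-- The sectional curvature, at the regular point `q` of `f`, of the metric induced by `f`, for the
plane spanned by the linearly independent tangent vectors `X` and `Y`. -/
def sectionalCurvature (f : M → Euc (m + 1)) (q : M) (X Y : TangentSpace (𝓡 m) q) : ℝ :=
  sectional (firstFormMatrix (chartRep f q)) (coordAt q) X Y

/-- The second fundamental form `II(X, Y) = -⟨df(X), dν(Y)⟩` with respect to the unit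
normal vector field `ν`. -/
def secondForm (f ν : M → Euc (m + 1)) (p : M) (X Y : TangentSpace (𝓡 m) p) : ℝ :=
  -inner ℝ (differential f p X) (differential ν p Y)

/-- `κ` is a singular principal curvature of `f` at the `A₂`-point `p`: an eigenvalue of the
singular shape operator. -/
def IsSingularPrincipalCurvature (f : M → Euc (m + 1)) (p : M) (κ : ℝ) : Prop :=
  ∃ (V : Set M) (ν : M → Euc (m + 1)), IsOpen V ∧ p ∈ V ∧ IsUnitNormalOn f ν V ∧
    ∃ W : Set (Euc m), IsOpen W ∧ coordAt p ∈ W ∧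
      W ⊆ (extChartAt (𝓡 m) p).target ∩ (extChartAt (𝓡 m) p).symm ⁻¹' V ∧
      ∃ S : Module.End ℝ (singularTangent (chartRep f p) (chartRep ν p) (coordAt p)),
        IsSingularShapeOperator (chartRep f p) (chartRep ν p) W (coordAt p) S ∧
        S.HasEigenvalue κ

end Manifolds

end WaveFront

end

/-!
By the Gauss equation the sectional curvature of the plane of `X` and `Y` is the quotient of
`II(X, X) II(Y, Y) - II(X, Y)²` by `I(X, X) I(Y, Y) - I(X, Y)²`.

Let `η` be a null vector at an `A₂`-point `p`. Along a line in the direction `η` the denominator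
belonging to `X` and `η` vanishes to second order at `p`, so a lower bound for the curvature forces
the derivative of `II(X, X) II(η, η)` at `p` to vanish. As `f` is a front, `II(η, η)` has a simple
zero at `p`, hence `II(X, X) = 0`. If the curvature is nonnegative, then `II(X, X)` and `II(η, η)`,
which both vanish at `p`, have derivatives of the same sign in the direction `η`; by the Codazzi
equation this is the sign condition on the singular shape operator.

For the local boundedness, the numerator is `⟨df X ∧ df Y, dν X ∧ dν Y⟩`. Where `II = 0` the rank
of `dν` is at most one, so near `p` the second factor is `O(|λ| |X ∧ Y|)`, and by Hadamard's
inequality `|λ| |X ∧ Y| = O(|df X ∧ df Y|)`. Hence the numerator is `O(|df X ∧ df Y|²)`, and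
`|df X ∧ df Y|²` is the denominator.
-/

namespace WaveFront

section PairDeterminants

variable {V E : Type*} [AddCommGroup V] [Module ℝ V]
  [NormedAddCommGroup E] [InnerProductSpace ℝ E]

/-- The `2 × 2` determinant `B(X, X) B(Y, Y) - B(X, Y)²` of a symmetric bilinear form. For the
first and the second fundamental form it is the denominator and the numerator of the sectional
curvature in the Gauss equation. -/
def pairDet (B : LinearMap.BilinForm ℝ V) (X Y : V) : ℝ :=
  B X X * B Y Y - B X Y ^ 2

/-- The pullback `⟨L X, L Y⟩` of the inner product under a linear map; for the differential of a
map to Euclidean space it is the first fundamental form. -/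
noncomputable def gramForm (L : V →ₗ[ℝ] E) : LinearMap.BilinForm ℝ V :=
  (innerₗ E).compl₁₂ L L

@[simp]
theorem gramForm_apply (L : V →ₗ[ℝ] E) (X Y : V) : gramForm L X Y = inner ℝ (L X) (L Y) := rfl

theorem gramForm_isSymm (L : V →ₗ[ℝ] E) : (gramForm L).IsSymm :=
  ⟨fun X Y => real_inner_comm (L Y) (L X)⟩

variable {B : LinearMap.BilinForm ℝ V} {L : V →ₗ[ℝ] E} {X Y : V}

theorem pairDet_eq_zero_of_not_linearIndependent (hXY : ¬ LinearIndependent ℝ ![X, Y]) :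
    pairDet B X Y = 0 := by
  by_cases hX : X = 0
  · simp [pairDet, hX]
  · rw [LinearIndependent.pair_iff' hX] at hXY
    push Not at hXY
    obtain ⟨a, rfl⟩ := hXY
    simp only [pairDet, map_smul, LinearMap.smul_apply, smul_eq_mul]
    ring

theorem pairDet_sub_smul_right (hB : B.IsSymm) (s : ℝ) :
    pairDet B X (Y - s • X) = pairDet B X Y := by
  have hYX : B Y X = B X Y := hB.eq Y X
  simp only [pairDet, map_sub, map_smul, LinearMap.sub_apply, LinearMap.smul_apply, smul_eq_mul,
    hYX]
  ring

theorem pairDet_gramForm_nonneg : 0 ≤ pairDet (gramForm L) X Y := by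
  have := real_inner_mul_inner_self_le (L X) (L Y)
  simp only [pairDet, gramForm_apply]
  linarith [sq (inner ℝ (L X) (L Y))]

theorem pairDet_gramForm_eq_mul (hX : L X ≠ 0) :
    pairDet (gramForm L) X Y =
      ‖L X‖ ^ 2 * ‖L (Y - (inner ℝ (L X) (L Y) / ‖L X‖ ^ 2) • X)‖ ^ 2 := by
  have hX' : ‖L X‖ ^ 2 ≠ 0 := by simpa using hX
  rw [← pairDet_sub_smul_right (gramForm_isSymm L) (inner ℝ (L X) (L Y) / ‖L X‖ ^ 2)]
  have horth : inner ℝ (L X) (L (Y - (inner ℝ (L X) (L Y) / ‖L X‖ ^ 2) • X)) = 0 := by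
    rw [map_sub, map_smul, inner_sub_right, inner_smul_right, real_inner_self_eq_norm_sq,
      div_mul_cancel₀ _ hX', sub_self]
  simp only [pairDet, gramForm_apply, horth, real_inner_self_eq_norm_sq]
  ring

theorem pairDet_gramForm_pos (hL : Function.Injective L) (hXY : LinearIndependent ℝ ![X, Y]) :
    0 < pairDet (gramForm L) X Y := by
  have hX : X ≠ 0 := hXY.ne_zero 0
  have hLne : ∀ Z, Z ≠ 0 → L Z ≠ 0 := fun Z hZ => (map_ne_zero_iff L hL).2 hZ
  rw [pairDet_gramForm_eq_mul (hLne X hX)]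
  have hY : Y - (inner ℝ (L X) (L Y) / ‖L X‖ ^ 2) • X ≠ 0 := fun h =>
    (LinearIndependent.pair_iff' hX).1 hXY _ (sub_eq_zero.1 h).symm
  have := hLne X hX
  have := hLne _ hY
  positivity

end PairDeterminants

section Determinants

variable {m n : ℕ}

theorem vecDet_ne_zero_iff (v : Fin n → Euc n) : vecDet v ≠ 0 ↔ LinearIndependent ℝ v := by
  rw [vecDet, ← isUnit_iff_ne_zero, ← Matrix.isUnit_iff_isUnit_det,
    ← Matrix.linearIndependent_rows_iff_isUnit]
  exact LinearMap.linearIndependent_iff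
    (WithLp.linearEquiv 2 ℝ (Fin n → ℝ)).toLinearMap (LinearEquiv.ker _)

/-- `vecDet` as a continuous multilinear map, which gives access to its derivative. -/
noncomputable def vecDetMultilinear (n : ℕ) :
    ContinuousMultilinearMap ℝ (fun _ : Fin n => Euc n) ℝ where
  toMultilinearMap :=
    (Matrix.detRowAlternating (R := ℝ) (n := Fin n)).toMultilinearMap.compLinearMap
      fun _ => (WithLp.linearEquiv 2 ℝ (Fin n → ℝ)).toLinearMap
  cont := by
    change Continuous fun v : Fin n → Euc n => Matrix.det (Matrix.of fun i j => v i j)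
    exact Continuous.matrix_det (continuous_matrix fun i j => by
      simp only [Matrix.of_apply]; fun_prop)

theorem vecDetMultilinear_apply (v : Fin n → Euc n) : vecDetMultilinear n v = vecDet v := rfl

theorem basisFun_det_eq_vecDet (b : Fin n → Euc n) :
    (EuclideanSpace.basisFun (Fin n) ℝ).toBasis.det b = vecDet b := by
  rw [Module.Basis.det_apply, vecDet, ← Matrix.det_transpose]
  rfl

theorem exists_vecDet_ne_zero_apply_eq {η : Euc n} (hη : η ≠ 0) :
    ∃ (b : Fin n → Euc n) (j : Fin n), vecDet b ≠ 0 ∧ b j = η := by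
  have hli : LinearIndepOn ℝ id ({η} : Set (Euc n)) := LinearIndepOn.singleton hη
  let B := Module.Basis.extend hli
  have : Fintype (hli.extend (Set.subset_univ _)) := FiniteDimensional.fintypeBasisIndex B
  let e := Fintype.equivFinOfCardEq <|
    (Module.finrank_eq_card_basis B).symm.trans (finrank_euclideanSpace_fin (n := n))
  refine ⟨B.reindex e, e ⟨η, hli.subset_extend _ rfl⟩,
    (vecDet_ne_zero_iff _).2 (B.reindex e).linearIndependent, ?_⟩
  simp [B]

/-- `coorientForm ν` as an alternating map. -/
noncomputable def coorientAlternating (ν : Euc (m + 1)) : (Euc (m + 1)) [⋀^Fin m]→ₗ[ℝ] ℝ where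
  toFun := coorientForm ν
  map_update_add' := by
    intro inst v i x y
    obtain rfl : inst = instDecidableEqFin m := Subsingleton.elim _ _
    simp only [coorientForm, Fin.snoc_update, ← vecDetMultilinear_apply]
    exact (vecDetMultilinear (m + 1)).map_update_add _ _ _ _
  map_update_smul' := by
    intro inst v i c x
    obtain rfl : inst = instDecidableEqFin m := Subsingleton.elim _ _
    simp only [coorientForm, Fin.snoc_update, ← vecDetMultilinear_apply]
    exact (vecDetMultilinear (m + 1)).map_update_smul _ _ _ _
  map_eq_zero_of_eq' := by
    intro v i j hv hij
    simp only [coorientForm, vecDet]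
    refine Matrix.det_zero_of_row_eq (i := i.castSucc) (j := j.castSucc) (by simpa using hij) ?_
    ext k
    simp [hv]

theorem coorientAlternating_apply (ν : Euc (m + 1)) (v : Fin m → Euc (m + 1)) :
    coorientAlternating ν v = coorientForm ν v := rfl

variable {ν z : Euc (m + 1)} {v : Fin m → Euc (m + 1)}

theorem coorientForm_smul_normal (c : ℝ) (ν : Euc (m + 1)) (v : Fin m → Euc (m + 1)) :
    coorientForm (c • ν) v = c * coorientForm ν v := by
  have h := (vecDetMultilinear (m + 1)).map_update_smul
    (Fin.snoc (α := fun _ => Euc (m + 1)) v ν) (Fin.last m) c ν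
  simpa [Fin.update_snoc_last, vecDetMultilinear_apply, coorientForm] using h

theorem coorientForm_ne_zero_iff (hν : ν ≠ 0) (hv : ∀ i, inner ℝ (v i) ν = 0) :
    coorientForm ν v ≠ 0 ↔ LinearIndependent ℝ v := by
  rw [coorientForm, vecDet_ne_zero_iff, linearIndependent_finSnoc, and_iff_left]
  intro hmem
  have hle : Submodule.span ℝ (Set.range v) ≤ (ℝ ∙ ν)ᗮ :=
    Submodule.span_le.2 <| Set.range_subset_iff.2 fun i =>
      Submodule.mem_orthogonal_singleton_iff_inner_left.2 (hv i)
  exact hν <| inner_self_eq_zero.1 <|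
    Submodule.mem_orthogonal_singleton_iff_inner_left.1 (hle hmem)

theorem eq_zero_of_inner_eq_zero (hdet : coorientForm ν v ≠ 0) (hv : ∀ i, inner ℝ z (v i) = 0)
    (hν : inner ℝ z ν = 0) : z = 0 := by
  have hli := (vecDet_ne_zero_iff _).1 hdet
  refine InnerProductSpace.ext_inner_right_basis
    (basisOfLinearIndependentOfCardEqFinrank hli (by simp)) fun i => ?_
  rw [inner_zero_left, coe_basisOfLinearIndependentOfCardEqFinrank]
  exact Fin.lastCases (by simpa using hν) (fun j => by simpa using hv j) i

theorem eq_inner_smul_of_forall_inner_eq_zero (hν : ‖ν‖ = 1) (hv : LinearIndependent ℝ v)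
    (hvν : ∀ i, inner ℝ (v i) ν = 0) (hz : ∀ i, inner ℝ z (v i) = 0) :
    z = inner ℝ z ν • ν := by
  have hν0 : ν ≠ 0 := by rintro rfl; simp at hν
  refine sub_eq_zero.1 <|
    eq_zero_of_inner_eq_zero ((coorientForm_ne_zero_iff hν0 hvν).2 hv) (fun i => ?_) ?_
  · rw [inner_sub_left, inner_smul_left, hz, real_inner_comm (v i) ν, hvν, mul_zero, sub_zero]
  · simp [inner_sub_left, inner_smul_left, hν]

theorem coorientForm_map (ν : Euc (m + 1)) (L : Euc m →ₗ[ℝ] Euc (m + 1)) (b : Fin m → Euc m) :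
    coorientForm ν (fun j => L (b j)) =
      vecDet b * coorientForm ν fun j => L (EuclideanSpace.single j 1) := by
  have h := DFunLike.congr_fun (AlternatingMap.eq_smul_basis_det
    (EuclideanSpace.basisFun (Fin m) ℝ).toBasis ((coorientAlternating ν).compLinearMap L)) b
  simpa [coorientAlternating_apply, basisFun_det_eq_vecDet, Function.comp_def, mul_comm] using h

section Calculus

variable {G : Type*} [NormedAddCommGroup G] [NormedSpace ℝ G]
  {v : Fin m → G → Euc (m + 1)} {N : G → Euc (m + 1)} {u : G}

theorem contDiffAt_coorientForm {k : WithTop ℕ∞} (hv : ∀ j, ContDiffAt ℝ k (v j) u)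
    (hN : ContDiffAt ℝ k N u) : ContDiffAt ℝ k (fun w => coorientForm (N w) fun j => v j w) u :=
  (vecDetMultilinear (m + 1)).contDiff.contDiffAt.comp u <| contDiffAt_pi.2 fun i =>
    Fin.lastCases (by simpa using hN) (fun j => by simpa using hv j) i

theorem fderiv_coorientForm_apply (hv : ∀ j, DifferentiableAt ℝ (v j) u)
    (hN : DifferentiableAt ℝ N u) (X : G) :
    fderiv ℝ (fun w => coorientForm (N w) fun j => v j w) u X =
      ∑ j, coorientForm (N u) (Function.update (fun j => v j u) j (fderiv ℝ (v j) u X)) +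
        coorientForm (fderiv ℝ N u X) fun j => v j u := by
  have key : HasFDerivAt (fun w => coorientForm (N w) fun j => v j w) _ u :=
    HasFDerivAt.multilinear_comp (vecDetMultilinear (m + 1))
      (g := fun i w => Fin.snoc (α := fun _ => Euc (m + 1)) (fun j => v j w) (N w) i)
      (g' := fun i => Fin.snoc (α := fun _ => G →L[ℝ] Euc (m + 1)) (fun j => fderiv ℝ (v j) u)
        (fderiv ℝ N u) i)
      fun i => Fin.lastCases (by simpa using hN.hasFDerivAt)
        (fun j => by simpa using (hv j).hasFDerivAt) i
  rw [key.fderiv]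
  simp only [FunLike.coe_sum, Finset.sum_apply, ContinuousLinearMap.comp_apply]
  rw [Fin.sum_univ_castSucc]
  simp [ContinuousMultilinearMap.toContinuousLinearMap, vecDetMultilinear_apply, coorientForm,
    Fin.snoc_update, Fin.update_snoc_last]

end Calculus

end Determinants

section PartialDerivatives

variable {m : ℕ} {E : Type*} [NormedAddCommGroup E] [NormedSpace ℝ E]
  {h : Euc m → E} {u : Euc m}

theorem eq_sum_smul_single (X : Euc m) : X = ∑ i, X i • EuclideanSpace.single i (1 : ℝ) := by
  simpa using ((EuclideanSpace.basisFun (Fin m) ℝ).sum_repr X).symm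

theorem fderiv_eq_sum_pd (h : Euc m → E) (u X : Euc m) :
    fderiv ℝ h u X = ∑ i, X i • pd i h u := by
  conv_lhs => rw [eq_sum_smul_single X]
  simp [pd]

theorem linearIndependent_pd_iff :
    LinearIndependent ℝ (fun i => pd i h u) ↔ Function.Injective (fderiv ℝ h u) := by
  let b := (EuclideanSpace.basisFun (Fin m) ℝ).toBasis
  have hb : (fun i => pd i h u) = (fderiv ℝ h u : Euc m →ₗ[ℝ] E) ∘ b := by
    ext1 i
    simp [b, pd]
  rw [hb]
  exact ⟨LinearMap.injective_of_linearIndependent b.span_eq,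
    fun hi => b.linearIndependent.map' _ (LinearMap.ker_eq_bot.2 hi)⟩

theorem contDiffAt_pd {k n : WithTop ℕ∞} (hh : ContDiffAt ℝ n h u) (hkn : k + 1 ≤ n)
    (i : Fin m) : ContDiffAt ℝ k (pd i h) u :=
  (hh.fderiv_right hkn).clm_apply contDiffAt_const

theorem fderiv_fderiv_apply {G : Type*} [NormedAddCommGroup G] [NormedSpace ℝ G] {h : G → E} {u : G}
    (hh : DifferentiableAt ℝ (fderiv ℝ h) u) (X Y : G) :
    fderiv ℝ (fun v => fderiv ℝ h v X) u Y = fderiv ℝ (fderiv ℝ h) u Y X := by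
  rw [fderiv_clm_apply hh (differentiableAt_const X)]
  simp

theorem pd_pd_eq (hh : ContDiffAt ℝ 2 h u) (i j : Fin m) :
    pd i (pd j h) u =
      fderiv ℝ (fderiv ℝ h) u (EuclideanSpace.single i 1) (EuclideanSpace.single j 1) :=
  fderiv_fderiv_apply ((hh.fderiv_right (m := 1) one_add_one_eq_two.le).differentiableAt
    one_ne_zero) _ _

theorem pd_comm (hh : ContDiffAt ℝ 2 h u) (i j : Fin m) :
    pd i (pd j h) u = pd j (pd i h) u := by
  rw [pd_pd_eq hh, pd_pd_eq hh, (hh.isSymmSndFDerivAt (by simp)).eq]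

theorem inner_fderiv_left_eq_neg {G E : Type*} [NormedAddCommGroup G] [NormedSpace ℝ G]
    [NormedAddCommGroup E] [InnerProductSpace ℝ E] {a b : G → E} {u : G} {c : ℝ}
    (ha : DifferentiableAt ℝ a u) (hb : DifferentiableAt ℝ b u)
    (hab : ∀ᶠ v in 𝓝 u, inner ℝ (a v) (b v) = c) (X : G) :
    inner ℝ (fderiv ℝ a u X) (b u) = -inner ℝ (a u) (fderiv ℝ b u X) := by
  have hconst : (fun v => inner ℝ (a v) (b v)) =ᶠ[𝓝 u] fun _ => c := hab
  have hderiv := fderiv_inner_apply ℝ ha hb X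
  rw [hconst.fderiv_eq, fderiv_fun_const] at hderiv
  exact eq_neg_of_add_eq_zero_right hderiv.symm

theorem inner_fderiv_eq_zero_of_norm_eq {G E : Type*} [NormedAddCommGroup G] [NormedSpace ℝ G]
    [NormedAddCommGroup E] [InnerProductSpace ℝ E] {a : G → E} {u : G} {c : ℝ}
    (ha : DifferentiableAt ℝ a u) (hnorm : ∀ᶠ v in 𝓝 u, ‖a v‖ = c) (X : G) :
    inner ℝ (fderiv ℝ a u X) (a u) = 0 := by
  have hsq : ∀ᶠ v in 𝓝 u, inner ℝ (a v) (a v) = c ^ 2 := hnorm.mono fun v hv => by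
    rw [real_inner_self_eq_norm_sq, hv]
  have h := inner_fderiv_left_eq_neg ha ha hsq X
  rw [real_inner_comm (fderiv ℝ a u X) (a u)] at h
  linarith

theorem eventually_injective_fderiv (hh : ContinuousAt (fderiv ℝ h) u)
    (hi : Function.Injective (fderiv ℝ h u)) :
    ∀ᶠ v in 𝓝 u, Function.Injective (fderiv ℝ h v) :=
  hh.eventually (ContinuousLinearMap.isOpen_injective.mem_nhds hi)

end PartialDerivatives

section MatrixCalculus

variable {ι G : Type*} [Fintype ι] [DecidableEq ι] [NormedAddCommGroup G] [NormedSpace ℝ G]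
  {A : G → Matrix ι ι ℝ} {u : G}

theorem differentiableAt_det (hA : ∀ i j, DifferentiableAt ℝ (fun v => A v i j) u) :
    DifferentiableAt ℝ (fun v => (A v).det) u := by
  simp only [Matrix.det_apply']
  fun_prop

theorem differentiableAt_inv_apply (hA : ∀ i j, DifferentiableAt ℝ (fun v => A v i j) u)
    (hu : (A u).det ≠ 0) (k l : ι) : DifferentiableAt ℝ (fun v => (A v)⁻¹ k l) u := by
  have hcramer : ∀ v, (A v)⁻¹ k l =
      ((A v).det)⁻¹ * ((A v).updateRow l (Pi.single k 1)).det := fun v => by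
    rw [Matrix.inv_def, Ring.inverse_eq_inv', Matrix.smul_apply, Matrix.adjugate_apply, smul_eq_mul]
  simp only [hcramer]
  refine ((differentiableAt_det hA).inv hu).mul (differentiableAt_det fun i j => ?_)
  by_cases hi : i = l
  · subst hi; simp
  · simpa [Matrix.updateRow_ne hi] using hA i j

end MatrixCalculus

section GaussEquation

variable {m : ℕ} {F : Euc m → Euc (m + 1)} {u : Euc m} {ν : Euc (m + 1)}

theorem metricApply_firstFormMatrix (F : Euc m → Euc (m + 1)) (u X Y : Euc m) :
    metricApply (firstFormMatrix F) u X Y = inner ℝ (fderiv ℝ F u X) (fderiv ℝ F u Y) := by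
  rw [fderiv_eq_sum_pd F u X, fderiv_eq_sum_pd F u Y, sum_inner, metricApply]
  refine Finset.sum_congr rfl fun i _ => ?_
  rw [inner_sum]
  refine Finset.sum_congr rfl fun j _ => ?_
  rw [inner_smul_left, inner_smul_right]
  simp [firstFormMatrix]
  ring

theorem det_firstFormMatrix_ne_zero (hi : Function.Injective (fderiv ℝ F u)) :
    (firstFormMatrix F u).det ≠ 0 :=
  Matrix.det_gram_ne_zero_iff_linearIndependent.2 (linearIndependent_pd_iff.2 hi)

theorem firstFormMatrix_comm (F : Euc m → Euc (m + 1)) (u : Euc m) (i j : Fin m) :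
    firstFormMatrix F u i j = firstFormMatrix F u j i :=
  real_inner_comm (pd j F u) (pd i F u)

theorem differentiableAt_firstFormMatrix (hF : ContDiffAt ℝ 2 F u) (i j : Fin m) :
    DifferentiableAt ℝ (fun v => firstFormMatrix F v i j) u :=
  have hpd : ∀ i, DifferentiableAt ℝ (pd i F) u := fun i =>
    (contDiffAt_pd (k := 1) hF one_add_one_eq_two.le i).differentiableAt one_ne_zero
  (hpd i).inner ℝ (hpd j)

theorem pd_firstFormMatrix (hF : ContDiffAt ℝ 2 F u) (i j l : Fin m) :
    pd i (fun v => firstFormMatrix F v j l) u =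
      inner ℝ (pd i (pd j F) u) (pd l F u) + inner ℝ (pd j F u) (pd i (pd l F) u) := by
  have hpd : ∀ i, DifferentiableAt ℝ (pd i F) u := fun i =>
    (contDiffAt_pd (k := 1) hF one_add_one_eq_two.le i).differentiableAt one_ne_zero
  exact (fderiv_inner_apply ℝ (hpd j) (hpd l) _).trans (add_comm _ _)

theorem christoffel_firstFormMatrix (hF : ContDiffAt ℝ 2 F u) (k i j : Fin m) :
    christoffel (firstFormMatrix F) k i j u =
      ∑ l, (firstFormMatrix F u)⁻¹ k l * inner ℝ (pd i (pd j F) u) (pd l F u) := by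
  rw [christoffel, Finset.mul_sum]
  refine Finset.sum_congr rfl fun l _ => ?_
  rw [pd_firstFormMatrix hF, pd_firstFormMatrix hF, pd_firstFormMatrix hF,
    pd_comm hF j i, pd_comm hF l i, pd_comm hF l j,
    real_inner_comm (pd i (pd l F) u), real_inner_comm (pd j (pd l F) u)]
  ring

theorem sum_christoffel_mul_firstFormMatrix (hF : ContDiffAt ℝ 2 F u)
    (hi : Function.Injective (fderiv ℝ F u)) (i j s : Fin m) :
    ∑ k, christoffel (firstFormMatrix F) k i j u * firstFormMatrix F u k s =
      inner ℝ (pd i (pd j F) u) (pd s F u) := by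
  have hinv : firstFormMatrix F u * (firstFormMatrix F u)⁻¹ = 1 :=
    Matrix.mul_nonsing_inv _ (det_firstFormMatrix_ne_zero hi).isUnit
  calc ∑ k, christoffel (firstFormMatrix F) k i j u * firstFormMatrix F u k s
      = ∑ l, (firstFormMatrix F u * (firstFormMatrix F u)⁻¹) s l *
          inner ℝ (pd i (pd j F) u) (pd l F u) := by
        simp only [christoffel_firstFormMatrix hF, firstFormMatrix_comm F u _ s, Finset.sum_mul,
          Matrix.mul_apply]
        rw [Finset.sum_comm]
        exact Finset.sum_congr rfl fun l _ => Finset.sum_congr rfl fun k _ => by ring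
    _ = inner ℝ (pd i (pd j F) u) (pd s F u) := by simp [hinv, Matrix.one_apply]

theorem differentiableAt_christoffel (hF : ContDiffAt ℝ 3 F u)
    (hi : Function.Injective (fderiv ℝ F u)) (k i j : Fin m) :
    DifferentiableAt ℝ (christoffel (firstFormMatrix F) k i j) u := by
  have hF₂ : ContDiffAt ℝ 2 F u := hF.of_le (by norm_num)
  have hpd : ∀ l, ContDiffAt ℝ 2 (pd l F) u := contDiffAt_pd hF (by norm_num)
  have hev : christoffel (firstFormMatrix F) k i j =ᶠ[𝓝 u] fun v =>
      ∑ l, (firstFormMatrix F v)⁻¹ k l * inner ℝ (pd i (pd j F) v) (pd l F v) := by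
    filter_upwards [hF₂.eventually (by simp)] with v hv using christoffel_firstFormMatrix hv k i j
  refine DifferentiableAt.congr_of_eventuallyEq ?_ hev
  refine DifferentiableAt.fun_sum fun l _ => DifferentiableAt.mul ?_ ?_
  · exact differentiableAt_inv_apply (differentiableAt_firstFormMatrix hF₂)
      (det_firstFormMatrix_ne_zero hi) k l
  · exact ((contDiffAt_pd (k := 1) (hpd j) (by norm_num) i).differentiableAt one_ne_zero).inner ℝ
      ((hpd l).differentiableAt two_ne_zero)

theorem gauss_formula (hF : ContDiffAt ℝ 2 F u) (hi : Function.Injective (fderiv ℝ F u))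
    (hν : ‖ν‖ = 1) (hνF : ∀ X, inner ℝ (fderiv ℝ F u X) ν = 0) (j k : Fin m) :
    pd j (pd k F) u = ∑ l, christoffel (firstFormMatrix F) l j k u • pd l F u +
      inner ℝ (pd j (pd k F) u) ν • ν := by
  set T := ∑ l, christoffel (firstFormMatrix F) l j k u • pd l F u with hT
  have hTν : inner ℝ T ν = 0 := by
    rw [hT, sum_inner]
    exact Finset.sum_eq_zero fun l _ => by rw [inner_smul_left, pd, hνF, mul_zero]
  have hTpd : ∀ s, inner ℝ (pd j (pd k F) u - T) (pd s F u) = 0 := fun s => by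
    rw [inner_sub_left, ← sum_christoffel_mul_firstFormMatrix hF hi, hT, sum_inner, sub_eq_zero]
    exact Finset.sum_congr rfl fun l _ => by simp [inner_smul_left, firstFormMatrix]
  have hnormal := eq_inner_smul_of_forall_inner_eq_zero hν (linearIndependent_pd_iff.2 hi)
    (fun l => hνF _) hTpd
  rw [inner_sub_left, hTν, sub_zero] at hnormal
  rw [← hnormal]
  abel

theorem pd_inner_pd_pd (hF : ContDiffAt ℝ 3 F u) (i j k s : Fin m) :
    pd i (fun v => inner ℝ (pd j (pd k F) v) (pd s F v)) u =
      inner ℝ (pd i (pd j (pd k F)) u) (pd s F u) +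
        inner ℝ (pd j (pd k F) u) (pd i (pd s F) u) := by
  have hpd : ∀ l, ContDiffAt ℝ 2 (pd l F) u := contDiffAt_pd hF (by norm_num)
  exact (fderiv_inner_apply ℝ
    ((contDiffAt_pd (k := 1) (hpd k) (by norm_num) j).differentiableAt one_ne_zero)
    ((hpd s).differentiableAt two_ne_zero) _).trans (add_comm _ _)

/- Differentiate `∑ₗ Γˡⱼₖ gₗₛ = ⟨Fⱼₖ, Fₛ⟩` in the direction `i` and resolve `Fⱼₖ` by the Gauss
formula. -/
theorem sum_firstFormMatrix_mul_pd_christoffel (hF : ContDiffAt ℝ 3 F u)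
    (hi : Function.Injective (fderiv ℝ F u)) (hν : ‖ν‖ = 1)
    (hνF : ∀ X, inner ℝ (fderiv ℝ F u X) ν = 0) (i j k s : Fin m) :
    ∑ l, firstFormMatrix F u l s * (pd i (christoffel (firstFormMatrix F) l j k) u +
        ∑ t, christoffel (firstFormMatrix F) t j k u * christoffel (firstFormMatrix F) l i t u) =
      inner ℝ (pd i (pd j (pd k F)) u) (pd s F u) +
        inner ℝ (pd j (pd k F) u) ν * inner ℝ (pd i (pd s F) u) ν := by
  have hF₂ : ContDiffAt ℝ 2 F u := hF.of_le (by norm_num)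
  set g := firstFormMatrix F with hg
  set Γ := christoffel g with hΓ
  have hderiv : ∑ l, (g u l s * pd i (Γ l j k) u + Γ l j k u * pd i (fun v => g v l s) u) =
      inner ℝ (pd i (pd j (pd k F)) u) (pd s F u) +
        inner ℝ (pd j (pd k F) u) (pd i (pd s F) u) := by
    have hev : (fun v => inner ℝ (pd j (pd k F) v) (pd s F v)) =ᶠ[𝓝 u]
        fun v => ∑ l, Γ l j k v * g v l s := by
      filter_upwards [hF₂.eventually (by simp), eventually_injective_fderiv
        (hF₂.continuousAt_fderiv two_ne_zero) hi] with v hv hiv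
      exact (sum_christoffel_mul_firstFormMatrix hv hiv j k s).symm
    have hΓd : ∀ l, DifferentiableAt ℝ (Γ l j k) u :=
      fun l => differentiableAt_christoffel hF hi l j k
    have hgd := fun l => differentiableAt_firstFormMatrix hF₂ l s
    rw [← pd_inner_pd_pd hF, pd, hev.fderiv_eq, fderiv_fun_sum fun l _ => (hΓd l).fun_mul (hgd l),
      sum_apply]
    refine Finset.sum_congr rfl fun l _ => ?_
    rw [fderiv_fun_mul (hΓd l) (hgd l)]
    simp [pd, hg]
    ring
  have hquad : ∑ l, g u l s * ∑ t, Γ t j k u * Γ l i t u =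
      ∑ t, Γ t j k u * inner ℝ (pd i (pd t F) u) (pd s F u) := by
    simp only [← sum_christoffel_mul_firstFormMatrix hF₂ hi, Finset.mul_sum]
    rw [Finset.sum_comm]
    exact Finset.sum_congr rfl fun t _ => Finset.sum_congr rfl fun l _ => by ring
  have hnormal : inner ℝ (pd j (pd k F) u) (pd i (pd s F) u) =
      ∑ l, Γ l j k u * inner ℝ (pd l F u) (pd i (pd s F) u) +
        inner ℝ (pd j (pd k F) u) ν * inner ℝ (pd i (pd s F) u) ν := by
    conv_lhs => rw [gauss_formula hF₂ hi hν hνF j k, ← hg, ← hΓ]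
    simp only [inner_add_left, sum_inner, inner_smul_left, RCLike.conj_to_real,
      real_inner_comm (pd i (pd s F) u) ν]
  simp only [hg, pd_firstFormMatrix hF₂, mul_add, Finset.sum_add_distrib] at hderiv hquad ⊢
  linarith

theorem gauss_equation (hF : ContDiffAt ℝ 3 F u) (hi : Function.Injective (fderiv ℝ F u))
    (hν : ‖ν‖ = 1) (hνF : ∀ X, inner ℝ (fderiv ℝ F u X) ν = 0) (s k i j : Fin m) :
    ∑ l, firstFormMatrix F u l s * riemann (firstFormMatrix F) l k i j u =
      inner ℝ (pd j (pd k F) u) ν * inner ℝ (pd i (pd s F) u) ν -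
        inner ℝ (pd i (pd k F) u) ν * inner ℝ (pd j (pd s F) u) ν := by
  have hij := sum_firstFormMatrix_mul_pd_christoffel hF hi hν hνF i j k s
  have hji := sum_firstFormMatrix_mul_pd_christoffel hF hi hν hνF j i k s
  rw [pd_comm (contDiffAt_pd hF (by norm_num) k) j i] at hji
  rw [← add_sub_add_left_eq_sub _ _ (inner ℝ (pd i (pd j (pd k F)) u) (pd s F u)), ← hij, ← hji,
    ← Finset.sum_sub_distrib]
  refine Finset.sum_congr rfl fun l _ => ?_
  rw [riemann, Finset.sum_sub_distrib]
  ring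

end GaussEquation

section UnitNormals

variable {m : ℕ}

/-- `N` is a smooth unit normal vector field along the smooth map `F` on the open set `Ω`. -/
structure IsNormalAlong (F N : Euc m → Euc (m + 1)) (Ω : Set (Euc m)) : Prop where
  isOpen : IsOpen Ω
  smooth_map : ContDiffOn ℝ ∞ F Ω
  smooth : ContDiffOn ℝ ∞ N Ω
  norm_eq : ∀ u ∈ Ω, ‖N u‖ = 1
  normal : ∀ u ∈ Ω, ∀ X, inner ℝ (fderiv ℝ F u X) (N u) = 0

/-- The second fundamental form `-⟨dF(X), dN(Y)⟩` in coordinates. -/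
noncomputable def sff (F N : Euc m → Euc (m + 1)) (u : Euc m) : LinearMap.BilinForm ℝ (Euc m) :=
  -(innerₗ (Euc (m + 1))).compl₁₂ (fderiv ℝ F u).toLinearMap (fderiv ℝ N u).toLinearMap

theorem sff_apply (F N : Euc m → Euc (m + 1)) (u X Y : Euc m) :
    sff F N u X Y = -inner ℝ (fderiv ℝ F u X) (fderiv ℝ N u Y) := rfl

/-- The first fundamental form `⟨dF(X), dF(Y)⟩` in coordinates. -/
noncomputable abbrev firstForm (F : Euc m → Euc (m + 1)) (u : Euc m) :
    LinearMap.BilinForm ℝ (Euc m) :=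
  gramForm (fderiv ℝ F u).toLinearMap

theorem isSymmSndFDerivAt_of_contDiffAt_infty {E G : Type*} [NormedAddCommGroup E]
    [NormedSpace ℝ E] [NormedAddCommGroup G] [NormedSpace ℝ G] {f : E → G} {x : E}
    (hf : ContDiffAt ℝ ∞ f x) : IsSymmSndFDerivAt ℝ f x :=
  ContDiffAt.isSymmSndFDerivAt (n := 2) (mod_cast contDiffAt_infty.1 hf 2) (by simp)

theorem vecDet_mul_jacobian (F N : Euc m → Euc (m + 1)) (u : Euc m) (b : Fin m → Euc m) :
    vecDet b * jacobian F N u = coorientForm (N u) fun j => fderiv ℝ F u (b j) :=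
  (coorientForm_map (N u) (fderiv ℝ F u : Euc m →ₗ[ℝ] Euc (m + 1)) b).symm

theorem frequently_jacobian_ne_zero {F N : Euc m → Euc (m + 1)} {u : Euc m}
    (hd : fderiv ℝ (jacobian F N) u ≠ 0) : ∃ᶠ v in 𝓝 u, jacobian F N v ≠ 0 := by
  intro hev
  have hzero : jacobian F N =ᶠ[𝓝 u] fun _ => (0 : ℝ) :=
    hev.mono fun _ => not_not.1
  exact hd (by rw [hzero.fderiv_eq, fderiv_fun_const, Pi.zero_apply])

namespace IsNormalAlong

variable {F N N' : Euc m → Euc (m + 1)} {Ω : Set (Euc m)} {u : Euc m}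

theorem mono (h : IsNormalAlong F N Ω) {Ω' : Set (Euc m)} (ho : IsOpen Ω') (hs : Ω' ⊆ Ω) :
    IsNormalAlong F N Ω' :=
  ⟨ho, h.smooth_map.mono hs, h.smooth.mono hs, fun u hu => h.norm_eq u (hs hu),
    fun u hu => h.normal u (hs hu)⟩

theorem mem_nhds (h : IsNormalAlong F N Ω) (hu : u ∈ Ω) : Ω ∈ 𝓝 u := h.isOpen.mem_nhds hu

theorem ne_zero (h : IsNormalAlong F N Ω) (hu : u ∈ Ω) : N u ≠ 0 := by
  rw [← norm_ne_zero_iff, h.norm_eq u hu]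
  exact one_ne_zero

theorem contDiffAt_map (h : IsNormalAlong F N Ω) (hu : u ∈ Ω) : ContDiffAt ℝ ∞ F u :=
  h.smooth_map.contDiffAt (h.mem_nhds hu)

theorem contDiffAt (h : IsNormalAlong F N Ω) (hu : u ∈ Ω) : ContDiffAt ℝ ∞ N u :=
  h.smooth.contDiffAt (h.mem_nhds hu)

theorem contDiffAt_fderiv_map (h : IsNormalAlong F N Ω) (hu : u ∈ Ω) :
    ContDiffAt ℝ ∞ (fderiv ℝ F) u :=
  (h.contDiffAt_map hu).fderiv_right (by simp)

theorem contDiffAt_fderiv (h : IsNormalAlong F N Ω) (hu : u ∈ Ω) :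
    ContDiffAt ℝ ∞ (fderiv ℝ N) u :=
  (h.contDiffAt hu).fderiv_right (by simp)

theorem differentiableAt (h : IsNormalAlong F N Ω) (hu : u ∈ Ω) : DifferentiableAt ℝ N u :=
  (h.contDiffAt hu).differentiableAt (by simp)

theorem differentiableAt_fderiv_map (h : IsNormalAlong F N Ω) (hu : u ∈ Ω) :
    DifferentiableAt ℝ (fderiv ℝ F) u :=
  (h.contDiffAt_fderiv_map hu).differentiableAt (by simp)

theorem differentiableAt_fderiv_map_apply (h : IsNormalAlong F N Ω) (hu : u ∈ Ω) (X : Euc m) :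
    DifferentiableAt ℝ (fun v => fderiv ℝ F v X) u :=
  (h.differentiableAt_fderiv_map hu).clm_apply (differentiableAt_const X)

theorem differentiableAt_fderiv_apply (h : IsNormalAlong F N Ω) (hu : u ∈ Ω) (X : Euc m) :
    DifferentiableAt ℝ (fun v => fderiv ℝ N v X) u :=
  ((h.contDiffAt_fderiv hu).differentiableAt (by simp)).clm_apply (differentiableAt_const X)

theorem fderiv_fderiv_symm (h : IsNormalAlong F N Ω) (hu : u ∈ Ω) (X Y : Euc m) :
    fderiv ℝ (fderiv ℝ F) u X Y = fderiv ℝ (fderiv ℝ F) u Y X :=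
  (isSymmSndFDerivAt_of_contDiffAt_infty (h.contDiffAt_map hu)).eq X Y

theorem inner_fderiv_self (h : IsNormalAlong F N Ω) (hu : u ∈ Ω) (X : Euc m) :
    inner ℝ (fderiv ℝ N u X) (N u) = 0 :=
  inner_fderiv_eq_zero_of_norm_eq (h.differentiableAt hu)
    (eventually_of_mem (h.mem_nhds hu) h.norm_eq) X

theorem sff_eq_inner_fderiv_fderiv (h : IsNormalAlong F N Ω) (hu : u ∈ Ω) (X Y : Euc m) :
    sff F N u X Y = inner ℝ (fderiv ℝ (fderiv ℝ F) u X Y) (N u) := by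
  rw [h.fderiv_fderiv_symm hu, ← fderiv_fderiv_apply (h.differentiableAt_fderiv_map hu),
    inner_fderiv_left_eq_neg (h.differentiableAt_fderiv_map_apply hu X) (h.differentiableAt hu)
      (eventually_of_mem (h.mem_nhds hu) fun v hv => h.normal v hv X), sff_apply]

theorem sff_isSymm (h : IsNormalAlong F N Ω) (hu : u ∈ Ω) : (sff F N u).IsSymm :=
  ⟨fun X Y => by
    simp only [h.sff_eq_inner_fderiv_fderiv hu, h.fderiv_fderiv_symm hu X Y]⟩

theorem sff_comm (h : IsNormalAlong F N Ω) (hu : u ∈ Ω) (X Y : Euc m) :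
    sff F N u X Y = sff F N u Y X :=
  (h.sff_isSymm hu).eq X Y

theorem sff_eq_zero_of_null (h : IsNormalAlong F N Ω) (hu : u ∈ Ω) {η : Euc m}
    (hη : fderiv ℝ F u η = 0) (X : Euc m) : sff F N u X η = 0 := by
  rw [h.sff_comm hu, sff_apply, hη, inner_zero_left, neg_zero]

theorem sff_eq_sum (h : IsNormalAlong F N Ω) (hu : u ∈ Ω) (X Y : Euc m) :
    sff F N u X Y = ∑ i, ∑ j, inner ℝ (pd i (pd j F) u) (N u) * X i * Y j := by
  have hF : ContDiffAt ℝ 2 F u := mod_cast contDiffAt_infty.1 (h.contDiffAt_map hu) 2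
  conv_lhs => rw [eq_sum_smul_single X, eq_sum_smul_single Y]
  simp only [map_sum, map_smul, LinearMap.sum_apply, LinearMap.smul_apply, smul_eq_mul,
    Finset.mul_sum, h.sff_eq_inner_fderiv_fderiv hu, ← pd_pd_eq hF]
  rw [Finset.sum_comm]
  exact Finset.sum_congr rfl fun i _ => Finset.sum_congr rfl fun j _ => by ring

theorem sectional_eq (h : IsNormalAlong F N Ω) (hu : u ∈ Ω)
    (hi : Function.Injective (fderiv ℝ F u)) (X Y : Euc m) :
    sectional (firstFormMatrix F) u X Y =
      pairDet (sff F N u) X Y / pairDet (firstForm F u) X Y := by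
  have hF : ContDiffAt ℝ 3 F u := mod_cast contDiffAt_infty.1 (h.contDiffAt_map hu) 3
  simp only [sectional, metricApply_firstFormMatrix]
  refine congrArg₂ _ ?_ rfl
  set II : Fin m → Fin m → ℝ := fun i j => inner ℝ (pd i (pd j F) u) (N u)
  have hgauss : ∀ i j k, ∑ l, ∑ s, firstFormMatrix F u l s * riemann (firstFormMatrix F) l k i j u *
      X i * Y j * Y k * X s =
      ∑ s, ((II i s * X i * X s) * (II j k * Y j * Y k) -
        (II i k * X i * Y k) * (II j s * Y j * X s)) := fun i j k => by
    rw [Finset.sum_comm]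
    refine Finset.sum_congr rfl fun s _ => ?_
    simp only [← Finset.sum_mul, gauss_equation hF hi (h.norm_eq u hu) (h.normal u hu)]
    ring
  have hcomm : sff F N u X Y ^ 2 = sff F N u X Y * sff F N u Y X := by rw [sq, h.sff_comm hu Y X]
  rw [pairDet, hcomm]
  simp only [hgauss, h.sff_eq_sum hu, Finset.sum_sub_distrib, ← Finset.sum_mul,
    ← Finset.mul_sum, II]

theorem jacobian_ne_zero_iff (h : IsNormalAlong F N Ω) (hu : u ∈ Ω) :
    jacobian F N u ≠ 0 ↔ Function.Injective (fderiv ℝ F u) :=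
  (coorientForm_ne_zero_iff (h.ne_zero hu) fun _ => h.normal u hu _).trans linearIndependent_pd_iff

theorem jacobian_eq_zero (h : IsNormalAlong F N Ω) (hu : u ∈ Ω) {η : Euc m} (hη : η ≠ 0)
    (hη₀ : fderiv ℝ F u η = 0) : jacobian F N u = 0 := by
  by_contra hne
  exact hη ((h.jacobian_ne_zero_iff hu).1 hne (by rw [hη₀, map_zero]))

theorem contDiffAt_jacobian (h : IsNormalAlong F N Ω) (hu : u ∈ Ω) :
    ContDiffAt ℝ ∞ (jacobian F N) u :=
  contDiffAt_coorientForm (fun j => contDiffAt_pd (h.contDiffAt_map hu) (by simp) j)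
    (h.contDiffAt hu)

theorem differentiableAt_jacobian (h : IsNormalAlong F N Ω) (hu : u ∈ Ω) :
    DifferentiableAt ℝ (jacobian F N) u :=
  (h.contDiffAt_jacobian hu).differentiableAt (by simp)

theorem vecDet_mul_fderiv_jacobian (h : IsNormalAlong F N Ω) (hu : u ∈ Ω) {b : Fin m → Euc m}
    {j : Fin m} (hj : fderiv ℝ F u (b j) = 0) (v : Euc m) :
    vecDet b * fderiv ℝ (jacobian F N) u v = coorientForm (N u)
      (Function.update (fun i => fderiv ℝ F u (b i)) j (fderiv ℝ (fderiv ℝ F) u v (b j))) := by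
  have hzero : ∀ (ν : Euc (m + 1)) {w : Fin m → Euc (m + 1)}, w j = 0 → coorientForm ν w = 0 :=
    fun ν _ hw => (coorientAlternating ν).map_coord_zero j hw
  have hderiv := fderiv_coorientForm_apply (v := fun i w => fderiv ℝ F w (b i))
    (fun i => h.differentiableAt_fderiv_map_apply hu (b i)) (h.differentiableAt hu) v
  simp only [← vecDet_mul_jacobian] at hderiv
  rw [fderiv_const_mul (h.differentiableAt_jacobian hu), hzero _ hj, add_zero,
    Finset.sum_eq_single_of_mem j (Finset.mem_univ j) fun i _ hi =>
      hzero _ (by rw [Function.update_of_ne hi.symm, hj]),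
    fderiv_fderiv_apply (h.differentiableAt_fderiv_map hu)] at hderiv
  simpa using hderiv

theorem exists_eq_smul_of_null (h : IsNormalAlong F N Ω) (hu : u ∈ Ω) {η : Euc m}
    (hη₀ : fderiv ℝ F u η = 0) (hη : fderiv ℝ (jacobian F N) u η ≠ 0) {X : Euc m}
    (hX : fderiv ℝ F u X = 0) : ∃ c : ℝ, X = c • η := by
  have hne : η ≠ 0 := by rintro rfl; simp at hη
  obtain ⟨b, j, hb, rfl⟩ := exists_vecDet_ne_zero_apply_eq hne
  have hli : LinearIndependent ℝ (Function.update (fun i => fderiv ℝ F u (b i)) j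
      (fderiv ℝ (fderiv ℝ F) u (b j) (b j))) := by
    have hdet := h.vecDet_mul_fderiv_jacobian hu hη₀ (b j) ▸ mul_ne_zero hb hη
    rw [coorientForm, vecDet_ne_zero_iff, linearIndependent_finSnoc] at hdet
    exact hdet.1
  have hspan := ((vecDet_ne_zero_iff b).1 hb).span_eq_top_of_card_eq_finrank' (by simp)
  obtain ⟨c, rfl⟩ := (Submodule.mem_span_range_iff_exists_fun ℝ).1
    (hspan ▸ Submodule.mem_top (x := X))
  have hc : ∀ i, Function.update c j 0 i = 0 := by
    refine Fintype.linearIndependent_iff.1 hli _ ?_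
    rw [← hX, map_sum]
    refine Finset.sum_congr rfl fun i _ => ?_
    by_cases hij : i = j
    · subst hij; simp [hη₀]
    · simp [hij]
  refine ⟨c j, Finset.sum_eq_single_of_mem j (Finset.mem_univ j) fun i _ hij => ?_⟩
  rw [← Function.update_of_ne hij (0 : ℝ) c, hc, zero_smul]

theorem inner_mul_self_eq_one (h : IsNormalAlong F N Ω) (h' : IsNormalAlong F N' Ω) (hu : u ∈ Ω)
    (hi : Function.Injective (fderiv ℝ F u)) :
    inner ℝ (N u) (N' u) * inner ℝ (N u) (N' u) = 1 := by
  have hN : N u = inner ℝ (N u) (N' u) • N' u :=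
    eq_inner_smul_of_forall_inner_eq_zero (h'.norm_eq u hu) (linearIndependent_pd_iff.2 hi)
      (fun _ => h'.normal u hu _) fun _ => by rw [real_inner_comm, pd, h.normal u hu]
  have hself : inner ℝ (N u) (N u) = (1 : ℝ) := by
    rw [real_inner_self_eq_norm_sq, h.norm_eq u hu, one_pow]
  nth_rewrite 2 [hN] at hself
  rwa [inner_smul_right] at hself

theorem continuousAt_inner (h : IsNormalAlong F N Ω) (h' : IsNormalAlong F N' Ω) (hu : u ∈ Ω) :
    ContinuousAt (fun v => inner ℝ (N v) (N' v)) u :=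
  (h.contDiffAt hu).continuousAt.inner (h'.contDiffAt hu).continuousAt

/- Regular points are dense near a point where `dλ ≠ 0`. -/
theorem eventually_inner_mul_self_eq_one (h : IsNormalAlong F N Ω) (h' : IsNormalAlong F N' Ω)
    (hu : u ∈ Ω) (hd : fderiv ℝ (jacobian F N') u ≠ 0) :
    ∀ᶠ v in 𝓝 u, inner ℝ (N v) (N' v) * inner ℝ (N v) (N' v) = 1 := by
  have hd' : ∀ᶠ v in 𝓝 u, fderiv ℝ (jacobian F N') v ≠ 0 :=
    (((h'.contDiffAt_jacobian hu).continuousAt_fderiv (by simp))).eventually_ne hd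
  filter_upwards [hd', h.mem_nhds hu] with v hv hvΩ
  by_contra hne
  have hne' := ((h.continuousAt_inner h' hvΩ).mul (h.continuousAt_inner h' hvΩ)).eventually_ne hne
  obtain ⟨w, hw, hw₁, hwΩ⟩ :=
    ((frequently_jacobian_ne_zero hv).and_eventually (hne'.and (h.mem_nhds hvΩ))).exists
  exact hw₁ (h.inner_mul_self_eq_one h' hwΩ ((h'.jacobian_ne_zero_iff hwΩ).1 hw))

end IsNormalAlong

theorem eventuallyEq_const_of_mul_self_eq_one {X : Type*} [TopologicalSpace X] {g : X → ℝ} {x : X}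
    (hg : ContinuousAt g x) (hsq : ∀ᶠ y in 𝓝 x, g y * g y = 1) : ∀ᶠ y in 𝓝 x, g y = g x := by
  have hx : g x * g x = 1 := hsq.self_of_nhds
  have hpos : ∀ᶠ y in 𝓝 x, 0 < g y * g x :=
    (hg.fun_mul continuousAt_const).eventually (lt_mem_nhds (zero_lt_one.trans_eq hx.symm))
  filter_upwards [hsq, hpos] with y hy hyx
  rcases mul_self_eq_mul_self_iff.1 (hy.trans hx.symm) with heq | heq
  · exact heq
  · rw [heq] at hyx
    linarith

namespace IsNormalAlong

variable {F N N' : Euc m → Euc (m + 1)} {Ω : Set (Euc m)} {u : Euc m}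

theorem exists_eventuallyEq_smul (h : IsNormalAlong F N Ω) (h' : IsNormalAlong F N' Ω)
    (hu : u ∈ Ω) (hd : fderiv ℝ (jacobian F N') u ≠ 0) :
    ∃ ε : ℝ, ε ≠ 0 ∧ N =ᶠ[𝓝 u] fun v => ε • N' v := by
  have hsq := h.eventually_inner_mul_self_eq_one h' hu hd
  refine ⟨inner ℝ (N u) (N' u), left_ne_zero_of_mul_eq_one hsq.self_of_nhds, ?_⟩
  filter_upwards [hsq, eventuallyEq_const_of_mul_self_eq_one (h.continuousAt_inner h' hu) hsq,
    h.mem_nhds hu] with v hv hvu hvΩ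
  have hε : |inner ℝ (N v) (N' v)| = 1 := by
    rw [← sq_eq_sq₀ (abs_nonneg _) zero_le_one, sq_abs, sq, hv, one_pow]
  rw [← hvu, ← inner_eq_one_iff_of_norm_eq_one (𝕜 := ℝ) (h.norm_eq v hvΩ), inner_smul_right, hv]
  rw [norm_smul, Real.norm_eq_abs, hε, h'.norm_eq v hvΩ, one_mul]

end IsNormalAlong

/-- `u` is an `A₂`-point of the front `F` with unit normal vector field `N` on `Ω`. -/
structure IsCuspidal (F N : Euc m → Euc (m + 1)) (Ω : Set (Euc m)) (u : Euc m) : Prop where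
  isNormal : IsNormalAlong F N Ω
  mem : u ∈ Ω
  front : ∀ X, fderiv ℝ F u X = 0 → fderiv ℝ N u X = 0 → X = 0
  null : ∃ η, fderiv ℝ F u η = 0 ∧ fderiv ℝ (jacobian F N) u η ≠ 0

variable {F N N' N'' : Euc m → Euc (m + 1)} {Ω : Set (Euc m)} {u : Euc m}

theorem fderiv_eq_zero_of_eventuallyEq_smul {ε : ℝ} (hε : ε ≠ 0)
    (hN : N =ᶠ[𝓝 u] fun v => ε • N' v) (hN' : DifferentiableAt ℝ N' u) {X : Euc m} :
    fderiv ℝ N u X = 0 ↔ fderiv ℝ N' u X = 0 := by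
  rw [hN.fderiv_eq, fderiv_fun_const_smul hN']
  simp [hε]

theorem fderiv_jacobian_of_eventuallyEq_smul {ε : ℝ} (hN : N =ᶠ[𝓝 u] fun v => ε • N' v)
    (hd : DifferentiableAt ℝ (jacobian F N') u) (X : Euc m) :
    fderiv ℝ (jacobian F N) u X = ε * fderiv ℝ (jacobian F N') u X := by
  have hj : jacobian F N =ᶠ[𝓝 u] fun v => ε * jacobian F N' v := by
    filter_upwards [hN] with v hv
    simp only [jacobian, hv, coorientForm_smul_normal]
  rw [hj.fderiv_eq, fderiv_const_mul hd]
  simp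

/- The two conditions may be checked on different unit normals, since all unit normals agree up to
sign. -/
theorem IsNormalAlong.isCuspidal (h : IsNormalAlong F N Ω) (h' : IsNormalAlong F N' Ω)
    (h'' : IsNormalAlong F N'' Ω) (hu : u ∈ Ω)
    (hnull : ∃ η, fderiv ℝ F u η = 0 ∧ fderiv ℝ (jacobian F N') u η ≠ 0)
    (hfront : ∀ X, fderiv ℝ F u X = 0 → fderiv ℝ N'' u X = 0 → X = 0) :
    IsCuspidal F N Ω u := by
  obtain ⟨η, hη₀, hη⟩ := hnull
  have hd : fderiv ℝ (jacobian F N') u ≠ 0 := fun hzero => hη (by rw [hzero, zero_apply])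
  obtain ⟨ε, hε, hN⟩ := h.exists_eventuallyEq_smul h' hu hd
  obtain ⟨ε'', hε'', hN''⟩ := h''.exists_eventuallyEq_smul h' hu hd
  have hN' := h'.differentiableAt hu
  refine ⟨h, hu, fun X hX hNX => hfront X hX ?_, η, hη₀, ?_⟩
  · rwa [fderiv_eq_zero_of_eventuallyEq_smul hε'' hN'' hN',
      ← fderiv_eq_zero_of_eventuallyEq_smul hε hN hN']
  · rw [fderiv_jacobian_of_eventuallyEq_smul hN (h'.differentiableAt_jacobian hu)]
    exact mul_ne_zero hε hη

end UnitNormals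

section CuspidalPoints

variable {m : ℕ} {F N : Euc m → Euc (m + 1)} {Ω : Set (Euc m)} {u : Euc m}

/-- The sectional curvature of the first fundamental form is at least `c` at the points of `Ω` where
`F` is regular. By the Gauss equation this is an inequality between the two fundamental forms. -/
def HasCurvatureGE (F N : Euc m → Euc (m + 1)) (Ω : Set (Euc m)) (c : ℝ) : Prop :=
  ∀ u ∈ Ω, Function.Injective (fderiv ℝ F u) → ∀ X Y,
    c * pairDet (firstForm F u) X Y ≤ pairDet (sff F N u) X Y

theorem mul_nonneg_of_hasDerivAt {a b : ℝ → ℝ} {a' b' x : ℝ} (ha : HasDerivAt a a' x)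
    (hb : HasDerivAt b b' x) (hax : a x = 0) (hbx : b x = 0)
    (hab : ∀ᶠ t in 𝓝[≠] x, 0 ≤ a t * b t) : 0 ≤ a' * b' := by
  refine ge_of_tendsto ((hasDerivAt_iff_tendsto_slope.1 ha).mul
    (hasDerivAt_iff_tendsto_slope.1 hb)) ?_
  filter_upwards [hab] with t ht
  rw [slope_def_field, slope_def_field, hax, hbx, sub_zero, sub_zero, div_mul_div_comm]
  exact div_nonneg ht (mul_self_nonneg _)

namespace IsNormalAlong

theorem fderiv_sff (h : IsNormalAlong F N Ω) (hu : u ∈ Ω) (X Y Z : Euc m) :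
    fderiv ℝ (fun v => sff F N v X Y) u Z =
      -(inner ℝ (fderiv ℝ F u X) (fderiv ℝ (fderiv ℝ N) u Z Y) +
        inner ℝ (fderiv ℝ (fderiv ℝ F) u Z X) (fderiv ℝ N u Y)) := by
  simp only [sff_apply]
  rw [fderiv_fun_neg, neg_apply, fderiv_inner_apply ℝ (h.differentiableAt_fderiv_map_apply hu X)
    (h.differentiableAt_fderiv_apply hu Y), fderiv_fderiv_apply (h.differentiableAt_fderiv_map hu),
    fderiv_fderiv_apply ((h.contDiffAt_fderiv hu).differentiableAt (by simp))]

theorem fderiv_sff_of_null (h : IsNormalAlong F N Ω) (hu : u ∈ Ω) {X : Euc m}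
    (hX : fderiv ℝ F u X = 0) (Y Z : Euc m) :
    fderiv ℝ (fun v => sff F N v X Y) u Z =
      -inner ℝ (fderiv ℝ (fderiv ℝ F) u Z X) (fderiv ℝ N u Y) := by
  rw [h.fderiv_sff hu, hX, inner_zero_left, zero_add]

theorem hasDerivAt_sff_line (h : IsNormalAlong F N Ω) (hu : u ∈ Ω) (X Y Z : Euc m) :
    HasDerivAt (fun t : ℝ => sff F N (u + t • Z) X Y) (fderiv ℝ (fun v => sff F N v X Y) u Z) 0 :=
  ((h.differentiableAt_fderiv_map_apply hu X).inner ℝ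
    (h.differentiableAt_fderiv_apply hu Y)).neg.hasFDerivAt.hasLineDerivAt Z

theorem hasDerivAt_pairDet_firstForm_line (h : IsNormalAlong F N Ω) (hu : u ∈ Ω) {X Y : Euc m}
    (hY : fderiv ℝ F u Y = 0) (Z : Euc m) :
    HasDerivAt (fun t : ℝ => pairDet (firstForm F (u + t • Z)) X Y) 0 0 := by
  have hX' := h.differentiableAt_fderiv_map_apply hu X
  have hY' := h.differentiableAt_fderiv_map_apply hu Y
  have hd : DifferentiableAt ℝ (fun v => pairDet (firstForm F v) X Y) u :=
    ((hX'.inner ℝ hX').mul (hY'.inner ℝ hY')).sub ((hX'.inner ℝ hY').pow 2)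
  have hline := hd.hasFDerivAt.hasLineDerivAt Z
  have hmin : IsLocalMin (fun v => pairDet (firstForm F v) X Y) u :=
    Eventually.of_forall fun v => by
      simpa [pairDet, hY] using pairDet_gramForm_nonneg (L := (fderiv ℝ F v).toLinearMap)
  rwa [hmin.hasLineDerivAt_eq_zero hline] at hline

theorem eventually_injective_fderiv_line (h : IsNormalAlong F N Ω) (hu : u ∈ Ω) {η : Euc m}
    (hη : fderiv ℝ (jacobian F N) u η ≠ 0) :
    ∀ᶠ t in 𝓝[≠] (0 : ℝ), u + t • η ∈ Ω ∧ Function.Injective (fderiv ℝ F (u + t • η)) := by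
  have hΩ : ∀ᶠ t in 𝓝 (0 : ℝ), u + t • η ∈ Ω :=
    (by fun_prop : ContinuousAt (fun t : ℝ => u + t • η) 0).eventually
      (by simpa using h.mem_nhds hu)
  have hline : HasDerivAt (fun t : ℝ => jacobian F N (u + t • η)) _ 0 :=
    (h.differentiableAt_jacobian hu).hasFDerivAt.hasLineDerivAt η
  filter_upwards [hΩ.filter_mono nhdsWithin_le_nhds, hline.eventually_ne hη (c := 0)] with t ht htη
  exact ⟨ht, (h.jacobian_ne_zero_iff ht).1 htη⟩

end IsNormalAlong

namespace IsCuspidal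

theorem inner_fderiv_null_ne_zero (h : IsCuspidal F N Ω u) {η : Euc m}
    (hη₀ : fderiv ℝ F u η = 0) (hη : fderiv ℝ (jacobian F N) u η ≠ 0) :
    inner ℝ (fderiv ℝ (fderiv ℝ F) u η η) (fderiv ℝ N u η) ≠ 0 := by
  intro hzero
  have hne : η ≠ 0 := by rintro rfl; simp at hη
  refine hne (h.front η hη₀ ?_)
  obtain ⟨b, j, hb, rfl⟩ := exists_vecDet_ne_zero_apply_eq hne
  have hdet := h.isNormal.vecDet_mul_fderiv_jacobian h.mem hη₀ (b j)
  refine eq_zero_of_inner_eq_zero (hdet ▸ mul_ne_zero hb hη) (fun i => ?_)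
    (h.isNormal.inner_fderiv_self h.mem _)
  rw [real_inner_comm]
  rcases eq_or_ne i j with rfl | hij
  · rwa [Function.update_self]
  · rw [Function.update_of_ne hij, ← neg_eq_zero]
    exact h.isNormal.sff_eq_zero_of_null h.mem hη₀ (b i)

/- Along a null line through `u` the product `II(X, X) II(η, η)` is, up to second order terms,
bounded below by `0`, although `II(η, η)` has a simple zero at `u`. -/
theorem sff_self_eq_zero (h : IsCuspidal F N Ω u) {c : ℝ} (hK : HasCurvatureGE F N Ω c)
    (X : Euc m) : sff F N u X X = 0 := by
  have hn := h.isNormal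
  obtain ⟨η, hη₀, hη⟩ := h.null
  have hII := hn.sff_eq_zero_of_null h.mem hη₀ η
  have hderiv := ((hn.hasDerivAt_sff_line h.mem X X η).fun_mul
    (hn.hasDerivAt_sff_line h.mem η η η)).fun_sub
    ((hn.hasDerivAt_pairDet_firstForm_line (X := X) h.mem hη₀ η).const_mul c)
  have hmin : IsLocalMin (fun t : ℝ => sff F N (u + t • η) X X * sff F N (u + t • η) η η -
      c * pairDet (firstForm F (u + t • η)) X η) 0 := by
    filter_upwards [eventually_nhdsWithin_iff.1 (hn.eventually_injective_fderiv_line h.mem hη)]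
      with t ht
    rcases eq_or_ne t 0 with rfl | ht₀
    · rfl
    · have hzero : pairDet (firstForm F u) X η = 0 := by simp [pairDet, hη₀]
      have hcurv := hK _ (ht ht₀).1 (ht ht₀).2 X η
      rw [pairDet.eq_def (sff F N _)] at hcurv
      simp only [zero_smul, add_zero, hII, hzero, mul_zero, sub_zero]
      nlinarith [sq_nonneg (sff F N (u + t • η) X η)]
  have hzero := hmin.hasDerivAt_eq_zero hderiv
  rw [hn.fderiv_sff_of_null h.mem hη₀] at hzero
  simpa [hII, h.inner_fderiv_null_ne_zero hη₀ hη] using hzero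

theorem sff_eq_zero (h : IsCuspidal F N Ω u) {c : ℝ} (hK : HasCurvatureGE F N Ω c) :
    sff F N u = 0 :=
  LinearMap.BilinForm.ext_of_isSymm (h.isNormal.sff_isSymm h.mem) LinearMap.BilinForm.isSymm_zero
    fun X => h.sff_self_eq_zero hK X

end IsCuspidal

end CuspidalPoints

section SnocFrame

variable {m : ℕ} {V V' : Type*} {e : Fin (m - 1) → V} {x : V} {j : Fin m}

theorem forall_snocFrame {p : V → Prop} (he : ∀ i, p (e i)) (hx : p x) (j : Fin m) :
    p (snocFrame e x j) := by
  rw [snocFrame]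
  split_ifs
  exacts [he _, hx]

theorem comp_snocFrame (g : V → V') (e : Fin (m - 1) → V) (x : V) (j : Fin m) :
    g (snocFrame e x j) = snocFrame (fun i => g (e i)) (g x) j :=
  apply_dite g _ _ _

theorem snocFrame_of_val_eq (hj : (j : ℕ) = m - 1) : snocFrame e x j = x :=
  dif_neg hj.not_lt

theorem update_snocFrame (hj : (j : ℕ) = m - 1) (y : V) :
    Function.update (snocFrame e x) j y = snocFrame e y := by
  ext1 k
  rcases eq_or_ne k j with rfl | hkj
  · rw [Function.update_self, snocFrame_of_val_eq hj]
  · have hk : (k : ℕ) < m - 1 := by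
      have := Fin.val_ne_of_ne hkj
      omega
    rw [Function.update_of_ne hkj, snocFrame, snocFrame, dif_pos hk, dif_pos hk]

theorem eq_zero_of_vecDet_snocFrame_ne_zero [AddCommGroup V'] [Module ℝ V']
    {e : Fin (m - 1) → Euc m} {x : Euc m} (hdet : vecDet (snocFrame e x) ≠ 0)
    {L : Euc m →ₗ[ℝ] V'} (he : ∀ i, L (e i) = 0) (hx : L x = 0) : L = 0 :=
  LinearMap.ext_on_range
    (((vecDet_ne_zero_iff _).1 hdet).span_eq_top_of_card_eq_finrank' (by simp))
    (forall_snocFrame (p := fun y => L y = 0) he hx)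

end SnocFrame

section SingularShapeOperator

variable {m : ℕ} {F N n : Euc m → Euc (m + 1)} {Ω W : Set (Euc m)} {u η X : Euc m}
  {e : Fin (m - 1) → Euc m → Euc m}

namespace IsConormalFrame

theorem eq_inner_smul (hf : IsConormalFrame F N W e n) (hu : u ∈ W) {z : Euc (m + 1)}
    (he : ∀ i, inner ℝ z (fderiv ℝ F u (e i u)) = 0) (hN : inner ℝ z (N u) = 0) :
    z = inner ℝ z (n u) • n u := by
  refine sub_eq_zero.1 (eq_zero_of_inner_eq_zero (hf.positive u hu).ne'
    (forall_snocFrame (p := fun x => inner ℝ (z - inner ℝ z (n u) • n u) x = 0) (fun i => ?_) ?_)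
    ?_)
  · simp only [inner_sub_left, inner_smul_left, he i, hf.inner_n_e u hu i, mul_zero, sub_zero]
  · simp [inner_sub_left, inner_smul_left, hf.norm_n u hu]
  · simp only [inner_sub_left, inner_smul_left, hN, hf.inner_n_normal u hu, mul_zero, sub_zero]

theorem coorientForm_snocFrame_eq_zero (hf : IsConormalFrame F N W e n) (hu : u ∈ W)
    {z : Euc (m + 1)} (hz : inner ℝ (n u) z = 0) :
    coorientForm (N u) (snocFrame (fun i => fderiv ℝ F u (e i u)) z) = 0 := by
  by_contra hdet
  have hn : n u = 0 := eq_zero_of_inner_eq_zero hdet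
    (forall_snocFrame (p := fun x => inner ℝ (n u) x = 0) (hf.inner_n_e u hu) hz)
    (hf.inner_n_normal u hu)
  simpa [hn] using hf.norm_n u hu

theorem coorientForm_snocFrame (hf : IsConormalFrame F N W e n) (hu : u ∈ W) (hm : 0 < m)
    (z : Euc (m + 1)) :
    coorientForm (N u) (snocFrame (fun i => fderiv ℝ F u (e i u)) z) = inner ℝ (n u) z *
      coorientForm (N u) (snocFrame (fun i => fderiv ℝ F u (e i u)) (n u)) := by
  let j : Fin m := ⟨m - 1, by omega⟩
  let φ : Euc (m + 1) →ₗ[ℝ] ℝ := (coorientAlternating (N u)).toMultilinearMap.toLinearMap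
    (snocFrame (fun i => fderiv ℝ F u (e i u)) 0) j
  have hφ : ∀ z, φ z = coorientForm (N u) (snocFrame (fun i => fderiv ℝ F u (e i u)) z) :=
    fun z => congrArg (coorientForm (N u)) (update_snocFrame (j := j) rfl z)
  have horth : inner ℝ (n u) (z - inner ℝ (n u) z • n u) = 0 := by
    rw [inner_sub_right, inner_smul_right, real_inner_self_eq_norm_sq, hf.norm_n u hu, one_pow,
      mul_one, sub_self]
  have hsub := hf.coorientForm_snocFrame_eq_zero hu horth
  rwa [← hφ, map_sub, map_smul, sub_eq_zero, hφ, hφ, smul_eq_mul] at hsub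

theorem inner_fderiv_map_eq_zero (hf : IsConormalFrame F N W e n) (hu : u ∈ W)
    (hη₀ : fderiv ℝ F u η = 0) (hdet : vecDet (snocFrame (fun i => e i u) η) ≠ 0) (Z : Euc m) :
    inner ℝ (n u) (fderiv ℝ F u Z) = 0 :=
  DFunLike.congr_fun (eq_zero_of_vecDet_snocFrame_ne_zero hdet
    (L := innerₗ _ (n u) ∘ₗ (fderiv ℝ F u).toLinearMap) (hf.inner_n_e u hu) (by simp [hη₀])) Z

theorem vecDet_mul_fderiv_jacobian (hf : IsConormalFrame F N W e n) (hu : u ∈ W)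
    (h : IsNormalAlong F N Ω) (huΩ : u ∈ Ω) (hm : 0 < m) (hη₀ : fderiv ℝ F u η = 0) (Z : Euc m) :
    vecDet (snocFrame (fun i => e i u) η) * fderiv ℝ (jacobian F N) u Z =
      inner ℝ (n u) (fderiv ℝ (fderiv ℝ F) u Z η) *
        coorientForm (N u) (snocFrame (fun i => fderiv ℝ F u (e i u)) (n u)) := by
  have hj : ((⟨m - 1, by omega⟩ : Fin m) : ℕ) = m - 1 := rfl
  have hderiv := h.vecDet_mul_fderiv_jacobian huΩ (b := snocFrame (fun i => e i u) η)
    (by rw [snocFrame_of_val_eq hj, hη₀]) Z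
  rwa [snocFrame_of_val_eq hj, funext (comp_snocFrame (fderiv ℝ F u) _ _), update_snocFrame hj,
    hf.coorientForm_snocFrame hu hm] at hderiv

theorem fderiv_normal_eq_smul (hf : IsConormalFrame F N W e n) (hu : u ∈ W)
    (h : IsNormalAlong F N Ω) (huΩ : u ∈ Ω) (hII : sff F N u = 0) (Z : Euc m) :
    fderiv ℝ N u Z = inner ℝ (fderiv ℝ N u Z) (n u) • n u := by
  refine hf.eq_inner_smul hu (fun i => ?_) (h.inner_fderiv_self huΩ Z)
  rw [real_inner_comm, ← neg_eq_zero, ← sff_apply, hII, LinearMap.zero_apply, LinearMap.zero_apply]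

theorem inner_fderiv_fderiv_frame (hf : IsConormalFrame F N W e n) (hW : W ∈ 𝓝 u)
    (hF : DifferentiableAt ℝ (fderiv ℝ F) u) (hη₀ : fderiv ℝ F u η = 0)
    (hdet : vecDet (snocFrame (fun i => e i u) η) ≠ 0) (i : Fin (m - 1)) (Z : Euc m) :
    inner ℝ (n u) (fderiv ℝ (fderiv ℝ F) u Z (e i u)) =
      -inner ℝ (fderiv ℝ n u Z) (fderiv ℝ F u (e i u)) := by
  have hn : DifferentiableAt ℝ n u := (hf.smooth_n.contDiffAt hW).differentiableAt (by simp)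
  have he : DifferentiableAt ℝ (e i) u := ((hf.smooth_e i).contDiffAt hW).differentiableAt (by simp)
  have hconst := inner_fderiv_left_eq_neg hn (hF.clm_apply he)
    (eventually_of_mem hW fun v hv => hf.inner_n_e v hv i) Z
  rw [fderiv_clm_apply hF he] at hconst
  simp only [add_apply, ContinuousLinearMap.comp_apply, ContinuousLinearMap.flip_apply,
    inner_add_right, hf.inner_fderiv_map_eq_zero (mem_of_mem_nhds hW) hη₀ hdet, zero_add] at hconst
  rw [hconst, neg_neg]

/- The two sides agree on the frame `e`, which spans `T_uΣ`. -/
theorem inner_fderiv_fderiv_eq_neg (hf : IsConormalFrame F N W e n) (hW : W ∈ 𝓝 u)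
    (hF : DifferentiableAt ℝ (fderiv ℝ F) u) (hη₀ : fderiv ℝ F u η = 0)
    (hdet : vecDet (snocFrame (fun i => e i u) η) ≠ 0) (hu₀ : jacobian F N u = 0)
    (hη : fderiv ℝ (jacobian F N) u η ≠ 0) (hX : X ∈ singularTangent F N u) (Z : Euc m) :
    inner ℝ (n u) (fderiv ℝ (fderiv ℝ F) u Z X) = -inner ℝ (fderiv ℝ n u Z) (fderiv ℝ F u X) := by
  set dl := fderiv ℝ (jacobian F N) u
  let L : Euc m →ₗ[ℝ] ℝ := innerₗ _ (n u) ∘ₗ (fderiv ℝ (fderiv ℝ F) u Z).toLinearMap +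
    innerₗ _ (fderiv ℝ n u Z) ∘ₗ (fderiv ℝ F u).toLinearMap
  have hL : L - (L η / dl η) • dl.toLinearMap = 0 := by
    refine eq_zero_of_vecDet_snocFrame_ne_zero hdet (fun i => ?_) ?_
    · have hLe : L (e i u) = 0 :=
        eq_neg_iff_add_eq_zero.1 (hf.inner_fderiv_fderiv_frame hW hF hη₀ hdet i Z)
      have hle : dl (e i u) = 0 := hf.tangent_e i u (mem_of_mem_nhds hW) hu₀
      simp [hLe, hle]
    · simp [hη]
  have hLX := DFunLike.congr_fun hL X
  have hlX : dl X = 0 := hX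
  simp only [LinearMap.sub_apply, LinearMap.smul_apply, ContinuousLinearMap.coe_coe, hlX, smul_zero,
    sub_zero] at hLX
  exact eq_neg_iff_add_eq_zero.2 hLX

end IsConormalFrame

theorem IsNormalAlong.codazzi_equation (h : IsNormalAlong F N Ω) (hu : u ∈ Ω) (X Y Z : Euc m) :
    fderiv ℝ (fun v => sff F N v X Y) u Z +
        inner ℝ (fderiv ℝ (fderiv ℝ F) u Z X) (fderiv ℝ N u Y) =
      fderiv ℝ (fun v => sff F N v X Z) u Y +
        inner ℝ (fderiv ℝ (fderiv ℝ F) u Y X) (fderiv ℝ N u Z) := by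
  rw [h.fderiv_sff hu, h.fderiv_sff hu,
    (isSymmSndFDerivAt_of_contDiffAt_infty (h.contDiffAt hu)).eq Y Z]
  ring

theorem IsNormalAlong.fderiv_sff_comm (h : IsNormalAlong F N Ω) (hu : u ∈ Ω) (X Y Z : Euc m) :
    fderiv ℝ (fun v => sff F N v X Y) u Z = fderiv ℝ (fun v => sff F N v Y X) u Z := by
  have heq : (fun v => sff F N v X Y) =ᶠ[𝓝 u] fun v => sff F N v Y X :=
    eventually_of_mem (h.mem_nhds hu) fun v hv => h.sff_comm hv X Y
  rw [heq.fderiv_eq]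

namespace IsCuspidal

theorem pos (h : IsCuspidal F N Ω u) : 0 < m := by
  obtain ⟨η, -, hη⟩ := h.null
  refine Nat.pos_of_ne_zero ?_
  rintro rfl
  exact hη (by rw [Subsingleton.elim η 0, map_zero])

theorem fderiv_jacobian_ne_zero (h : IsCuspidal F N Ω u) (hη : η ≠ 0)
    (hη₀ : fderiv ℝ F u η = 0) : fderiv ℝ (jacobian F N) u η ≠ 0 := by
  obtain ⟨ξ, hξ₀, hξ⟩ := h.null
  obtain ⟨c, rfl⟩ := h.isNormal.exists_eq_smul_of_null h.mem hξ₀ hξ hη₀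
  rw [map_smul, smul_eq_mul]
  exact mul_ne_zero (left_ne_zero_of_smul hη) hξ

theorem fderiv_map_ne_zero (h : IsCuspidal F N Ω u) (hX : X ∈ singularTangent F N u)
    (hX₀ : X ≠ 0) : fderiv ℝ F u X ≠ 0 :=
  fun hzero => h.fderiv_jacobian_ne_zero hX₀ hzero hX

theorem fderiv_sff_mul_nonneg (h : IsCuspidal F N Ω u) (hK : HasCurvatureGE F N Ω 0)
    (hη : fderiv ℝ (jacobian F N) u η ≠ 0) (X : Euc m) :
    0 ≤ fderiv ℝ (fun v => sff F N v X X) u η * fderiv ℝ (fun v => sff F N v η η) u η := by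
  have hn := h.isNormal
  refine mul_nonneg_of_hasDerivAt (hn.hasDerivAt_sff_line h.mem X X η)
    (hn.hasDerivAt_sff_line h.mem η η η) ?_ ?_ ?_
  · simp [h.sff_eq_zero hK]
  · simp [h.sff_eq_zero hK]
  · filter_upwards [hn.eventually_injective_fderiv_line h.mem hη] with t ht
    have hcurv := hK _ ht.1 ht.2 X η
    rw [zero_mul, pairDet] at hcurv
    linarith [sq_nonneg (sff F N (u + t • η) X η)]

variable (h : IsCuspidal F N Ω u) (hf : IsConormalFrame F N W e n) (hW : W ∈ 𝓝 u)
  (hη₀ : fderiv ℝ F u η = 0) (hX : X ∈ singularTangent F N u)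

include h hf hW hη₀ hX

theorem inner_fderiv_fderiv_null_eq_zero (hII : sff F N u = 0) :
    inner ℝ (fderiv ℝ (fderiv ℝ F) u X η) (fderiv ℝ N u X) = 0 := by
  have huW := mem_of_mem_nhds hW
  have hjac := hf.vecDet_mul_fderiv_jacobian huW h.isNormal h.mem h.pos hη₀ X
  have hlX : fderiv ℝ (jacobian F N) u X = 0 := hX
  rw [hlX, mul_zero, eq_comm, mul_eq_zero, or_iff_left (hf.positive u huW).ne'] at hjac
  rw [hf.fderiv_normal_eq_smul huW h.isNormal h.mem hII, inner_smul_right,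
    real_inner_comm (n u) (fderiv ℝ (fderiv ℝ F) u X η), hjac, mul_zero]

theorem fderiv_sff_self (hII : sff F N u = 0) {c : ℝ} (hc : fderiv ℝ N u η = c • n u) :
    fderiv ℝ (fun v => sff F N v X X) u η =
      c * inner ℝ (n u) (fderiv ℝ (fderiv ℝ F) u X X) := by
  have hn := h.isNormal
  have hXη := h.inner_fderiv_fderiv_null_eq_zero hf hW hη₀ hX hII
  have hcodazzi := hn.codazzi_equation h.mem X X η
  rwa [hn.fderiv_sff_comm h.mem X η, hn.fderiv_sff_of_null h.mem hη₀,
    hn.fderiv_fderiv_symm h.mem η X, hXη, add_zero, neg_zero, zero_add, hc, inner_smul_right,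
    real_inner_comm] at hcodazzi

theorem inner_fderiv_conormal_mul_nonneg (hK : HasCurvatureGE F N Ω 0) (hη : η ≠ 0)
    (hdet : 0 < vecDet (snocFrame (fun i => e i u) η)) :
    0 ≤ inner ℝ (fderiv ℝ n u X) (fderiv ℝ F u X) * fderiv ℝ (jacobian F N) u η := by
  have hn := h.isNormal
  have huW := mem_of_mem_nhds hW
  have hII := h.sff_eq_zero hK
  have hdη := h.fderiv_jacobian_ne_zero hη hη₀
  obtain ⟨c, hc⟩ : ∃ c : ℝ, fderiv ℝ N u η = c • n u :=
    ⟨_, hf.fderiv_normal_eq_smul huW hn h.mem hII η⟩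
  have hc₀ : c ≠ 0 := by
    rintro rfl
    exact hη (h.front η hη₀ (by rw [hc, zero_smul]))
  have hprod := h.fderiv_sff_mul_nonneg hK hdη X
  rw [h.fderiv_sff_self hf hW hη₀ hX hII hc, hf.inner_fderiv_fderiv_eq_neg hW
    (hn.differentiableAt_fderiv_map h.mem) hη₀ hdet.ne' (hn.jacobian_eq_zero h.mem hη hη₀) hdη hX,
    hn.fderiv_sff_of_null h.mem hη₀, hc, inner_smul_right, real_inner_comm (n u)] at hprod
  have hjac := hf.vecDet_mul_fderiv_jacobian huW hn h.mem h.pos hη₀ η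
  refine nonneg_of_mul_nonneg_right (a := c ^ 2 * vecDet (snocFrame (fun i => e i u) η)) ?_
    (by positivity)
  convert mul_nonneg hprod (hf.positive u huW).le using 1
  linear_combination c ^ 2 * inner ℝ (fderiv ℝ n u X) (fderiv ℝ F u X) * hjac

end IsCuspidal

theorem sign_mul_nonneg {a b : ℝ} (h : 0 ≤ a * b) (hb : b ≠ 0) : 0 ≤ Real.sign b * a := by
  rcases hb.lt_or_gt with hneg | hpos
  · rw [Real.sign_of_neg hneg]
    linarith [nonpos_of_mul_nonneg_left h hneg]
  · rw [Real.sign_of_pos hpos, one_mul]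
    exact nonneg_of_mul_nonneg_left h hpos

theorem IsCuspidal.hasEigenvalue_nonpos (h : IsCuspidal F N Ω u) (hK : HasCurvatureGE F N Ω 0)
    (hW : W ∈ 𝓝 u) {S : Module.End ℝ (singularTangent F N u)}
    (hS : IsSingularShapeOperator F N W u S) {κ : ℝ} (hκ : S.HasEigenvalue κ) : κ ≤ 0 := by
  obtain ⟨e, n, η, hf, hη₀, hdet, hS⟩ := hS
  obtain ⟨⟨X, hXt⟩, hX⟩ := hκ.exists_hasEigenvector
  have hη : η ≠ 0 := by
    have hne := ((vecDet_ne_zero_iff _).1 hdet.ne').ne_zero ⟨m - 1, Nat.sub_one_lt h.pos.ne'⟩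
    rwa [snocFrame_of_val_eq rfl] at hne
  have hFX : fderiv ℝ F u X ≠ 0 :=
    h.fderiv_map_ne_zero hXt fun hX₀ => hX.2 (Subtype.ext hX₀)
  have hsign := sign_mul_nonneg (h.inner_fderiv_conormal_mul_nonneg hf hW hη₀ hXt hK hη hdet)
    (h.fderiv_jacobian_ne_zero hη hη₀)
  have hSX := congrArg (inner ℝ · (fderiv ℝ F u X)) (hS ⟨X, hXt⟩)
  simp only [hX.apply_eq_smul, SetLike.mk_smul_mk, map_smul, inner_smul_left, inner_neg_left,
    tangentialDeriv, inner_sub_left, real_inner_comm (fderiv ℝ F u X) (N u),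
    h.isNormal.normal u h.mem, real_inner_self_eq_norm_sq, conj_trivial, mul_zero,
    sub_zero] at hSX
  refine nonpos_of_mul_nonpos_left ?_ (pow_pos (norm_pos_iff.2 hFX) 2)
  rw [hSX]
  exact neg_nonpos.2 hsign

end SingularShapeOperator

section WedgeProducts

variable {V E : Type*} [NormedAddCommGroup V] [InnerProductSpace ℝ V]
  [NormedAddCommGroup E] [InnerProductSpace ℝ E]

theorem pairDet_smul_smul (B : LinearMap.BilinForm ℝ V) (s t : ℝ) (X Y : V) :
    pairDet B (s • X) (t • Y) = (s * t) ^ 2 * pairDet B X Y := by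
  simp only [pairDet, map_smul, LinearMap.smul_apply, smul_eq_mul]
  ring

theorem abs_pairDet_le_of_forall_orthonormal {B G : LinearMap.BilinForm ℝ V} {C : ℝ}
    (hB : B.IsSymm) (hG : G.IsSymm)
    (h : ∀ X Y, Orthonormal ℝ ![X, Y] → |pairDet B X Y| ≤ C * pairDet G X Y) (X Y : V) :
    |pairDet B X Y| ≤ C * pairDet G X Y := by
  by_cases hli : LinearIndependent ℝ ![X, Y]
  · have hX : X ≠ 0 := hli.ne_zero 0
    set s := inner ℝ X Y / ‖X‖ ^ 2
    set Z := Y - s • X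
    have hZ : Z ≠ 0 := fun hZ => (LinearIndependent.pair_iff' hX).1 hli s (sub_eq_zero.1 hZ).symm
    have hXZ : inner ℝ X Z = 0 := by
      rw [inner_sub_right, inner_smul_right, real_inner_self_eq_norm_sq,
        div_mul_cancel₀ _ (by simpa using hX), sub_self]
    have horth : Orthonormal ℝ ![‖X‖⁻¹ • X, ‖Z‖⁻¹ • Z] :=
      orthonormal_vecCons_iff.2 ⟨by simp [hX, norm_smul],
        by simp [inner_smul_left, inner_smul_right, hXZ], by simp [hZ, norm_smul]⟩
    have hle := h _ _ horth
    rw [pairDet_smul_smul, pairDet_smul_smul, abs_mul, abs_sq, mul_left_comm] at hle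
    rw [← pairDet_sub_smul_right hB s, ← pairDet_sub_smul_right hG s]
    exact le_of_mul_le_mul_left hle (by positivity)
  · simp [pairDet_eq_zero_of_not_linearIndependent hli]

/-- The inner product `⟨x ∧ y, a ∧ b⟩` of two bivectors. -/
def wedgeInner (x y a b : E) : ℝ :=
  inner ℝ x a * inner ℝ y b - inner ℝ x b * inner ℝ y a

theorem wedgeInner_sub_smul (x y a b : E) (s : ℝ) :
    wedgeInner x (y - s • x) a b = wedgeInner x y a b := by
  simp only [wedgeInner, inner_sub_left, inner_smul_left, conj_trivial]
  ring

theorem wedgeInner_eq_zero_of_not_linearIndependent {a b : E} (h : ¬ LinearIndependent ℝ ![a, b])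
    (x y : E) : wedgeInner x y a b = 0 := by
  by_cases ha : a = 0
  · simp [wedgeInner, ha]
  · rw [LinearIndependent.pair_iff' ha] at h
    push Not at h
    obtain ⟨c, rfl⟩ := h
    simp only [wedgeInner, inner_smul_right]
    ring

theorem abs_inner_clm_mul_inner_clm_le (x y : E) (A B : V →L[ℝ] E) (X Y : V) :
    |inner ℝ x (A X) * inner ℝ y (B Y)| ≤ ‖A‖ * ‖B‖ * (‖x‖ * ‖y‖) * (‖X‖ * ‖Y‖) := by
  rw [abs_mul]
  calc |inner ℝ x (A X)| * |inner ℝ y (B Y)| ≤ ‖x‖ * ‖A X‖ * (‖y‖ * ‖B Y‖) := by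
        gcongr <;> exact abs_real_inner_le_norm _ _
    _ ≤ ‖x‖ * (‖A‖ * ‖X‖) * (‖y‖ * (‖B‖ * ‖Y‖)) := by
        gcongr <;> exact ContinuousLinearMap.le_opNorm _ _
    _ = _ := by ring

theorem abs_wedgeInner_map_le (x y : E) {A A₀ : V →L[ℝ] E} {X Y : V}
    (h₀ : ¬ LinearIndependent ℝ ![A₀ X, A₀ Y]) :
    |wedgeInner x y (A X) (A Y)| ≤
      2 * ‖A - A₀‖ * (‖A‖ + ‖A₀‖) * (‖x‖ * ‖y‖) * (‖X‖ * ‖Y‖) := by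
  have hsplit : wedgeInner x y (A X) (A Y) =
      (inner ℝ x ((A - A₀) X) * inner ℝ y (A Y) + inner ℝ x (A₀ X) * inner ℝ y ((A - A₀) Y)) -
      (inner ℝ x ((A - A₀) Y) * inner ℝ y (A X) +
        inner ℝ x (A₀ Y) * inner ℝ y ((A - A₀) X)) := by
    have h := wedgeInner_eq_zero_of_not_linearIndependent h₀ x y
    simp only [wedgeInner, sub_apply, inner_sub_right] at h ⊢
    linear_combination h
  have h₁ := abs_inner_clm_mul_inner_clm_le x y (A - A₀) A X Y
  have h₂ := abs_inner_clm_mul_inner_clm_le x y A₀ (A - A₀) X Y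
  have h₃ := abs_inner_clm_mul_inner_clm_le x y (A - A₀) A Y X
  have h₄ := abs_inner_clm_mul_inner_clm_le x y A₀ (A - A₀) Y X
  rw [hsplit]
  refine (abs_sub _ _).trans ((add_le_add (abs_add_le _ _) (abs_add_le _ _)).trans ?_)
  linarith

end WedgeProducts

section JacobianBounds

variable {m : ℕ}

theorem abs_coorientForm_le (ν : Euc (m + 1)) (v : Fin m → Euc (m + 1)) :
    |coorientForm ν v| ≤ ‖vecDetMultilinear (m + 1)‖ * ((∏ i, ‖v i‖) * ‖ν‖) := by
  have h := (vecDetMultilinear (m + 1)).le_opNorm (Fin.snoc (α := fun _ => Euc (m + 1)) v ν)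
  rw [vecDetMultilinear_apply, ← coorientForm, Real.norm_eq_abs] at h
  simpa only [Fin.prod_univ_castSucc, Fin.snoc_castSucc, Fin.snoc_last] using h

theorem abs_coorientForm_map_orthonormalBasis (ν : Euc (m + 1)) (L : Euc m →ₗ[ℝ] Euc (m + 1))
    (b : OrthonormalBasis (Fin m) ℝ (Euc m)) :
    |coorientForm ν fun i => L (b i)| =
      |coorientForm ν fun i => L (EuclideanSpace.single i 1)| := by
  rw [coorientForm_map, abs_mul, ← basisFun_det_eq_vecDet]
  rcases (EuclideanSpace.basisFun (Fin m) ℝ).det_to_matrix_orthonormalBasis_real b with h | h <;>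
    simp [h]

theorem exists_orthonormalBasis_apply_eq {X Y : Euc m} (hXY : Orthonormal ℝ ![X, Y]) :
    ∃ (b : OrthonormalBasis (Fin m) ℝ (Euc m)) (i j : Fin m), i ≠ j ∧ b i = X ∧ b j = Y := by
  have hm : 2 ≤ m := by simpa using hXY.linearIndependent.fintype_card_le_finrank
  let i : Fin m := ⟨0, by omega⟩
  let j : Fin m := ⟨1, by omega⟩
  have hij : i ≠ j := by simp [i, j]
  have horth : Orthonormal ℝ
      (({i, j} : Set (Fin m)).domRestrict (Function.update (fun _ => X) j Y)) := by
    constructor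
    · rintro ⟨k, rfl | rfl⟩
      · simpa [Set.domRestrict, hij] using hXY.1 0
      · simpa [Set.domRestrict] using hXY.1 1
    · rintro ⟨k, rfl | rfl⟩ ⟨l, rfl | rfl⟩ hkl
      · exact absurd rfl hkl
      · simpa [Set.domRestrict, hij] using hXY.2 (zero_ne_one (α := Fin 2))
      · simpa [Set.domRestrict, hij] using hXY.2 (one_ne_zero (α := Fin 2))
      · exact absurd rfl hkl
  obtain ⟨b, hb⟩ := horth.exists_orthonormalBasis_extension_of_card_eq (by simp)
  exact ⟨b, i, j, hij, by simpa [hij] using hb i (by simp), by simpa using hb j (by simp)⟩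

theorem abs_coorientForm_map_le (ν : Euc (m + 1)) (L : Euc m →L[ℝ] Euc (m + 1)) {X Y : Euc m}
    (hXY : Orthonormal ℝ ![X, Y]) (s : ℝ) :
    |coorientForm ν fun i => L (EuclideanSpace.single i 1)| ≤
      ‖vecDetMultilinear (m + 1)‖ * max 1 ‖L‖ ^ m * ‖ν‖ * (‖L X‖ * ‖L (Y - s • X)‖) := by
  obtain ⟨b, i, j, hij, rfl, rfl⟩ := exists_orthonormalBasis_apply_eq hXY
  set v : Fin m → Euc (m + 1) := fun k => L (b k)
  set w := Function.update v j (L (b j - s • b i))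
  have hvw : coorientForm ν v = coorientForm ν w := by
    simp only [w, ← coorientAlternating_apply, map_sub, map_smul, AlternatingMap.map_update_sub,
      AlternatingMap.map_update_smul]
    rw [show L (b i) = v i from rfl, show L (b j) = v j from rfl, Function.update_eq_self,
      AlternatingMap.map_update_self _ _ hij.symm, smul_zero, sub_zero]
  have hprod : ∏ k, ‖w k‖ ≤ max 1 ‖L‖ ^ m * (‖L (b i)‖ * ‖L (b j - s • b i)‖) := by
    calc ∏ k, ‖w k‖ ≤ ∏ k, max 1 ‖L‖ * (Pi.mulSingle (M := fun _ => ℝ) i ‖L (b i)‖ k *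
          Pi.mulSingle (M := fun _ => ℝ) j ‖L (b j - s • b i)‖ k) := by
          refine Finset.prod_le_prod (fun k _ => norm_nonneg _) fun k _ => ?_
          rcases eq_or_ne k j with rfl | hkj
          · simpa [w, hij.symm] using le_mul_of_one_le_left (norm_nonneg _) (le_max_left _ _)
          rcases eq_or_ne k i with rfl | hki
          · simpa [w, v, hkj] using le_mul_of_one_le_left (norm_nonneg _) (le_max_left _ _)
          · simpa [w, v, hkj, hki] using Or.inr (L.le_opNorm (b k))
      _ = _ := by simp [Finset.prod_mul_distrib, Finset.prod_pi_mulSingle']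
  calc |coorientForm ν fun i => L (EuclideanSpace.single i 1)| = |coorientForm ν w| := by
        rw [← hvw]
        exact (abs_coorientForm_map_orthonormalBasis ν L.toLinearMap b).symm
    _ ≤ ‖vecDetMultilinear (m + 1)‖ * ((∏ k, ‖w k‖) * ‖ν‖) := abs_coorientForm_le ν w
    _ ≤ ‖vecDetMultilinear (m + 1)‖ *
        (max 1 ‖L‖ ^ m * (‖L (b i)‖ * ‖L (b j - s • b i)‖) * ‖ν‖) := by gcongr
    _ = _ := by ring

end JacobianBounds

section MetricRegularity

variable {V E : Type*} [NormedAddCommGroup V] [NormedSpace ℝ V] [CompleteSpace V]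
  [NormedAddCommGroup E] [NormedSpace ℝ E] [CompleteSpace E]

/- Metric regularity of `f` at `a`, the quantitative form of the open mapping property. -/
theorem exists_tendsto_isBigO_of_hasStrictFDerivAt {f : V → E} {f' : V →L[ℝ] E} {a : V}
    (hf : HasStrictFDerivAt f f' a) (hsurj : f'.range = ⊤) :
    ∃ w : V → V, Tendsto w (𝓝 a) (𝓝 a) ∧ (∀ᶠ v in 𝓝 a, f (w v) = f a) ∧
      (fun v => v - w v) =O[𝓝 a] fun v => f v - f a := by
  let g := f'.nonlinearRightInverseOfSurjective hsurj
  have hg : 0 < g.nnnorm := f'.nonlinearRightInverseOfSurjective_nnnorm_pos hsurj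
  obtain ⟨t, ht, happrox⟩ :=
    hf.approximates_deriv_on_nhds (c := g.nnnorm⁻¹ / 2) (Or.inr (by positivity))
  obtain ⟨r, hr, hball⟩ := Metric.mem_nhds_iff.1 ht
  have hlim : Tendsto (fun v => f v - f a) (𝓝 a) (𝓝 0) := by
    simpa using hf.continuousAt.tendsto.sub_const (f a)
  have hsmall : ∀ᶠ v in 𝓝 a, 2 * g.nnnorm * ‖f v - f a‖ < r / 2 :=
    (hlim.norm.const_mul _).eventually_lt_const (by simpa using hr)
  have hsolve : ∀ᶠ v in 𝓝 a, ∃ w, f w = f a ∧ ‖v - w‖ ≤ 2 * g.nnnorm * ‖f v - f a‖ := by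
    filter_upwards [hsmall, Metric.ball_mem_nhds a (half_pos hr)] with v hv hva
    have hsub : Metric.closedBall v (2 * (g.nnnorm : ℝ) * ‖f v - f a‖) ⊆ t :=
      (Metric.closedBall_subset_ball' (by linarith [Metric.mem_ball.1 hva])).trans hball
    have hmem : f a ∈ Metric.closedBall (f v)
        (((g.nnnorm : ℝ)⁻¹ - ↑(g.nnnorm⁻¹ / 2)) * (2 * (g.nnnorm : ℝ) * ‖f v - f a‖)) := by
      have hg' : (g.nnnorm : ℝ) ≠ 0 := by positivity
      rw [mem_closedBall_iff_norm']
      refine le_of_eq ?_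
      simp only [NNReal.coe_div, NNReal.coe_inv, NNReal.coe_ofNat]
      field_simp
      ring
    obtain ⟨w, hw, hfw⟩ :=
      happrox.surjOn_closedBall_of_nonlinearRightInverse g (by positivity) hsub hmem
    exact ⟨w, hfw, mem_closedBall_iff_norm'.1 hw⟩
  obtain ⟨w, hw⟩ := hsolve.choice
  have hO : (fun v => v - w v) =O[𝓝 a] fun v => f v - f a :=
    .of_bound _ (hw.mono fun v hv => hv.2)
  refine ⟨w, ?_, hw.mono fun v hv => hv.1, hO⟩
  simpa using tendsto_id.sub (hO.trans_tendsto hlim)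

end MetricRegularity

section LocalBoundedness

variable {m : ℕ} {F N : Euc m → Euc (m + 1)} {Ω : Set (Euc m)} {u η : Euc m}

theorem not_linearIndependent_pair_of_inner_eq_zero {ν z a c : Euc (m + 1)}
    {v : Fin m → Euc (m + 1)} {j : Fin m} (hdet : coorientForm ν (Function.update v j z) ≠ 0)
    (ha : ∀ i, inner ℝ a (v i) = 0) (haν : inner ℝ a ν = 0)
    (hc : ∀ i, inner ℝ c (v i) = 0) (hcν : inner ℝ c ν = 0) :
    ¬ LinearIndependent ℝ ![a, c] := by
  have heq_zero : ∀ x, (∀ i, inner ℝ x (v i) = 0) → inner ℝ x ν = 0 → inner ℝ x z = 0 →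
      x = 0 := by
    refine fun x hx hxν hxz => eq_zero_of_inner_eq_zero hdet (fun i => ?_) hxν
    rcases eq_or_ne i j with rfl | hij
    · simpa using hxz
    · simpa [hij] using hx i
  intro hli
  have hac := heq_zero (inner ℝ c z • a + -inner ℝ a z • c)
    (by simp [inner_add_left, inner_smul_left, ha, hc])
    (by simp [inner_add_left, inner_smul_left, haν, hcν])
    (by simp only [inner_add_left, inner_smul_left, conj_trivial]; ring)
  exact hli.ne_zero 0 <|
    heq_zero a ha haν (neg_eq_zero.1 (LinearIndependent.pair_iff.1 hli _ _ hac).2)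

namespace IsNormalAlong

theorem pairDet_sff (h : IsNormalAlong F N Ω) (hu : u ∈ Ω) (X Y : Euc m) :
    pairDet (sff F N u) X Y =
      wedgeInner (fderiv ℝ F u X) (fderiv ℝ F u Y) (fderiv ℝ N u X) (fderiv ℝ N u Y) := by
  have hsymm := h.sff_comm hu X Y
  simp only [sff_apply] at hsymm
  simp only [pairDet, wedgeInner, sff_apply]
  linear_combination inner ℝ (fderiv ℝ F u X) (fderiv ℝ N u Y) * hsymm

theorem abs_pairDet_sff_le (h : IsNormalAlong F N Ω) (hu : u ∈ Ω) {A : Euc m →L[ℝ] Euc (m + 1)}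
    (hA : ∀ X Y, ¬ LinearIndependent ℝ ![A X, A Y]) {C : ℝ} (hC : 0 ≤ C)
    (hNA : ‖fderiv ℝ N u - A‖ ≤ C * |jacobian F N u|) (X Y : Euc m) :
    |pairDet (sff F N u) X Y| ≤
      2 * C * (‖fderiv ℝ N u‖ + ‖A‖) *
        (‖vecDetMultilinear (m + 1)‖ * max 1 ‖fderiv ℝ F u‖ ^ m) *
        pairDet (firstForm F u) X Y := by
  refine abs_pairDet_le_of_forall_orthonormal (h.sff_isSymm hu) (gramForm_isSymm _)
    (fun X Y hXY => ?_) X Y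
  rw [h.pairDet_sff hu]
  by_cases hX : fderiv ℝ F u X = 0
  · simp [wedgeInner, pairDet, hX]
  set s := inner ℝ (fderiv ℝ F u X) (fderiv ℝ F u Y) / ‖fderiv ℝ F u X‖ ^ 2
  set R := ‖vecDetMultilinear (m + 1)‖ * max 1 ‖fderiv ℝ F u‖ ^ m
  set a := ‖fderiv ℝ F u X‖ * ‖fderiv ℝ F u (Y - s • X)‖
  have hfirst : pairDet (firstForm F u) X Y = a ^ 2 :=
    (pairDet_gramForm_eq_mul hX).trans (mul_pow _ _ 2).symm
  have hjac : |jacobian F N u| ≤ R * a := by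
    have hle := abs_coorientForm_map_le (N u) (fderiv ℝ F u) hXY s
    rwa [h.norm_eq u hu, mul_one] at hle
  have hX1 : ‖X‖ = 1 := hXY.1 0
  have hY1 : ‖Y‖ = 1 := hXY.1 1
  have hwedge := abs_wedgeInner_map_le (fderiv ℝ F u X) (fderiv ℝ F u (Y - s • X))
    (A := fderiv ℝ N u) (hA X Y)
  rw [map_sub, map_smul, wedgeInner_sub_smul, ← map_smul, ← map_sub, hX1, hY1, mul_one,
    mul_one] at hwedge
  calc _ ≤ 2 * ‖fderiv ℝ N u - A‖ * (‖fderiv ℝ N u‖ + ‖A‖) * a := hwedge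
    _ ≤ 2 * (C * (R * a)) * (‖fderiv ℝ N u‖ + ‖A‖) * a := by
        gcongr
        exact hNA.trans (by gcongr)
    _ = _ := by rw [hfirst]; ring

theorem exists_abs_pairDet_sff_le (h : IsNormalAlong F N Ω) (hu : u ∈ Ω)
    {A : Euc m → Euc m →L[ℝ] Euc (m + 1)}
    (hA : ∀ᶠ v in 𝓝 u, ∀ X Y, ¬ LinearIndependent ℝ ![A v X, A v Y])
    (hNA : (fun v => fderiv ℝ N v - A v) =O[𝓝 u] jacobian F N) :
    ∃ C : ℝ, ∀ᶠ v in 𝓝 u, ∀ X Y,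
      |pairDet (sff F N v) X Y| ≤ C * pairDet (firstForm F v) X Y := by
  obtain ⟨c, hc, hO⟩ := hNA.exists_nonneg
  have hjac := (h.contDiffAt_jacobian hu).continuousAt
  have hdF := (h.contDiffAt_fderiv_map hu).continuousAt
  have hdN := (h.contDiffAt_fderiv hu).continuousAt
  set φ : Euc m → ℝ := fun v =>
    2 * c * (‖fderiv ℝ N v‖ + (‖fderiv ℝ N v‖ + c * |jacobian F N v|)) *
      (‖vecDetMultilinear (m + 1)‖ * max 1 ‖fderiv ℝ F v‖ ^ m)
  have hφ : ContinuousAt φ u := by fun_prop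
  refine ⟨φ u + 1, ?_⟩
  filter_upwards [hA, hO.bound, h.mem_nhds hu, hφ.eventually_lt_const (lt_add_one _)]
    with v hAv hOv hv hφv X Y
  have hAnorm : ‖A v‖ ≤ ‖fderiv ℝ N v‖ + c * |jacobian F N v| :=
    (norm_le_norm_add_norm_sub _ _).trans (by gcongr; exact hOv)
  have hG : 0 ≤ pairDet (firstForm F v) X Y := pairDet_gramForm_nonneg
  calc _ ≤ _ := h.abs_pairDet_sff_le hv hAv hc hOv X Y
    _ ≤ φ v * pairDet (firstForm F v) X Y := by simp only [φ]; gcongr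
    _ ≤ (φ u + 1) * pairDet (firstForm F v) X Y := by gcongr

theorem exists_abs_pairDet_sff_le_of_injective (h : IsNormalAlong F N Ω) (hu : u ∈ Ω)
    (hi : Function.Injective (fderiv ℝ F u)) :
    ∃ C : ℝ, ∀ᶠ v in 𝓝 u, ∀ X Y,
      |pairDet (sff F N v) X Y| ≤ C * pairDet (firstForm F v) X Y := by
  have hj := (h.jacobian_ne_zero_iff hu).2 hi
  refine h.exists_abs_pairDet_sff_le hu (A := fun _ => 0)
    (.of_forall fun _ X Y hli => hli.ne_zero 0 rfl) ?_
  have hone : (fun _ => (1 : ℝ)) =Θ[𝓝 u] jacobian F N :=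
    Asymptotics.isTheta_of_div_tendsto_nhds_ne_zero
      (by simpa using (h.contDiffAt_jacobian hu).continuousAt.tendsto) hj
  simpa only [sub_zero] using
    ((h.contDiffAt_fderiv hu).continuousAt.tendsto.isBigO_one ℝ).trans hone.1

theorem eventually_not_linearIndependent_fderiv (h : IsNormalAlong F N Ω) (hu : u ∈ Ω)
    (hη : fderiv ℝ F u η = 0) (hd : fderiv ℝ (jacobian F N) u η ≠ 0) :
    ∀ᶠ v in 𝓝 u, sff F N v = 0 → ∀ X Y,
      ¬ LinearIndependent ℝ ![fderiv ℝ N v X, fderiv ℝ N v Y] := by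
  have hη0 : η ≠ 0 := fun h0 => hd (by rw [h0, map_zero])
  obtain ⟨b, j, hb, rfl⟩ := exists_vecDet_ne_zero_apply_eq hη0
  set z := fderiv ℝ (fderiv ℝ F) u (b j) (b j)
  set D : Euc m → ℝ := fun v =>
    coorientForm (N v) (Function.update (fun i => fderiv ℝ F v (b i)) j z)
  have hDu : D u ≠ 0 := by
    have heq : vecDet b * fderiv ℝ (jacobian F N) u (b j) = D u :=
      h.vecDet_mul_fderiv_jacobian hu hη (b j)
    exact heq ▸ mul_ne_zero hb hd
  have hcont : ContinuousAt D u := by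
    refine (contDiffAt_coorientForm (k := ∞) (v := fun i v =>
      Function.update (fun i => fderiv ℝ F v (b i)) j z i) (fun i => ?_)
      (h.contDiffAt hu)).continuousAt
    rcases eq_or_ne i j with rfl | hij
    · simpa using contDiffAt_const
    · simpa [hij] using (h.contDiffAt_fderiv_map hu).clm_apply contDiffAt_const
  filter_upwards [hcont.eventually_ne hDu, h.mem_nhds hu] with v hDv hv hII X Y
  have horth : ∀ X i, inner ℝ (fderiv ℝ N v X) (fderiv ℝ F v (b i)) = 0 := fun X i => by
    have := congr($hII (b i) X)
    rw [real_inner_comm]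
    simpa [sff_apply] using this
  exact not_linearIndependent_pair_of_inner_eq_zero hDv (horth X) (h.inner_fderiv_self hv X)
    (horth Y) (h.inner_fderiv_self hv Y)

end IsNormalAlong

theorem IsCuspidal.exists_abs_pairDet_sff_le (h : IsCuspidal F N Ω u)
    (hII : ∀ v ∈ Ω, jacobian F N v = 0 → sff F N v = 0) :
    ∃ C : ℝ, ∀ᶠ v in 𝓝 u, ∀ X Y,
      |pairDet (sff F N v) X Y| ≤ C * pairDet (firstForm F v) X Y := by
  obtain ⟨η, hη, hd⟩ := h.null
  have hn := h.isNormal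
  have hη0 : η ≠ 0 := fun h0 => hd (by rw [h0, map_zero])
  have hjac : jacobian F N u = 0 := hn.jacobian_eq_zero h.mem hη0 hη
  have hsurj : (fderiv ℝ (jacobian F N) u).range = ⊤ :=
    LinearMap.range_eq_top.2 (LinearMap.surjective fun h0 => hd congr($h0 η))
  obtain ⟨w, hw, hjw, hO⟩ := exists_tendsto_isBigO_of_hasStrictFDerivAt
    ((hn.contDiffAt_jacobian h.mem).hasStrictFDerivAt (by simp)) hsurj
  simp only [hjac, sub_zero] at hjw hO
  refine hn.exists_abs_pairDet_sff_le h.mem (A := fun v => fderiv ℝ N (w v)) ?_ ?_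
  · filter_upwards [hjw, hw (hn.mem_nhds h.mem),
      hw.eventually (hn.eventually_not_linearIndependent_fderiv h.mem hη hd)] with v hv hmem hrank
    exact hrank (hII _ hmem hv)
  · have hlip := ((hn.contDiffAt_fderiv h.mem).hasStrictFDerivAt (by simp)).isBigO_sub
    exact (hlip.comp_tendsto (tendsto_id.prodMk_nhds hw)).trans hO

end LocalBoundedness

section Charts

variable {m : ℕ} {M : Type*} [TopologicalSpace M] [ChartedSpace (Euc m) M]
  {f ν : M → Euc (m + 1)} {U V : Set M} {p q : M} {u : Euc m}

/-- The differential at `q` of the preferred chart at `p`, which carries the differential of a map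
at `q` to the derivative of its representation in that chart. -/
noncomputable def chartDifferential (p q : M) : Euc m →L[ℝ] Euc m :=
  mfderiv (𝓡 m) 𝓘(ℝ, Euc m) (extChartAt (𝓡 m) p) q

/-- The part of `V` that lies in the domain of the preferred chart at `p`, in the coordinates of
that chart. -/
def chartImage (p : M) (V : Set M) : Set (Euc m) :=
  (extChartAt (𝓡 m) p).target ∩ (extChartAt (𝓡 m) p).symm ⁻¹' V

theorem isOpen_chartImage (p : M) (hV : IsOpen V) : IsOpen (chartImage (m := m) p V) :=
  (continuousOn_extChartAt_symm p).isOpen_inter_preimage (isOpen_extChartAt_target p) hV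

theorem chartImage_mono (hVU : V ⊆ U) : chartImage (m := m) p V ⊆ chartImage p U :=
  inter_subset_inter_right _ (preimage_mono hVU)

theorem extChartAt_mem_chartImage (hq : q ∈ (extChartAt (𝓡 m) p).source) (hqV : q ∈ V) :
    extChartAt (𝓡 m) p q ∈ chartImage p V :=
  ⟨(extChartAt (𝓡 m) p).map_source hq, by rwa [mem_preimage, (extChartAt (𝓡 m) p).left_inv hq]⟩

theorem exists_extChartAt_eq_of_mem_chartImage (hu : u ∈ chartImage p V) :
    ∃ q ∈ (extChartAt (𝓡 m) p).source, q ∈ V ∧ extChartAt (𝓡 m) p q = u :=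
  ⟨_, (extChartAt (𝓡 m) p).map_target hu.1, hu.2, (extChartAt (𝓡 m) p).right_inv hu.1⟩

theorem IsA2Point.exists_null (hp : IsA2Point f p) :
    ∃ (V : Set M) (ν : M → Euc (m + 1)), IsOpen V ∧ p ∈ V ∧ IsUnitNormalOn f ν V ∧
      ∃ η, fderiv ℝ (chartRep f p) (coordAt p) η = 0 ∧
        fderiv ℝ (jacobian (chartRep f p) (chartRep ν p)) (coordAt p) η ≠ 0 := by
  obtain ⟨-, V, ν, hV, hpV, hν, hd, htop⟩ := hp
  refine ⟨V, ν, hV, hpV, hν, ?_⟩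
  by_contra! hker
  have hle : LinearMap.ker (fderiv ℝ (chartRep f p) (coordAt p) : Euc m →ₗ[ℝ] Euc (m + 1)) ≤
      singularTangent (chartRep f p) (chartRep ν p) (coordAt p) := fun x hx => hker x hx
  rw [sup_eq_right.2 hle] at htop
  exact hd (ContinuousLinearMap.ext fun x => (htop ▸ Submodule.mem_top :
    x ∈ singularTangent (chartRep f p) (chartRep ν p) (coordAt p)))

theorem IsUnitNormalOn.mdifferentiableAt (h : IsUnitNormalOn f ν V) (hV : IsOpen V) (hqV : q ∈ V) :
    MDifferentiableAt (𝓡 m) 𝓘(ℝ, Euc (m + 1)) ν q :=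
  (h.smooth.contMDiffAt (hV.mem_nhds hqV)).mdifferentiableAt (by simp)

variable [IsManifold (𝓡 m) ∞ M]

theorem bijective_chartDifferential (hq : q ∈ (extChartAt (𝓡 m) p).source) :
    Function.Bijective (chartDifferential (m := m) p q) := by
  have : IsManifold (𝓡 m) 1 M := IsManifold.of_le (n := ∞) (by simp)
  obtain ⟨e, he⟩ := isInvertible_mfderiv_extChartAt (I := 𝓡 m) hq
  have hcoe : ⇑(chartDifferential p q) = e := congrArg DFunLike.coe he.symm
  exact hcoe ▸ e.bijective

theorem chartDifferential_self (p : M) :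
    chartDifferential p p = ContinuousLinearMap.id ℝ (Euc m) := by
  have : IsManifold (𝓡 m) 1 M := IsManifold.of_le (n := ∞) (by simp)
  exact mfderiv_extChartAt_self

theorem linearIndependent_chartDifferential_iff (hq : q ∈ (extChartAt (𝓡 m) p).source)
    (X Y : Euc m) :
    LinearIndependent ℝ ![chartDifferential p q X, chartDifferential p q Y] ↔
      LinearIndependent ℝ ![X, Y] := by
  have hker := LinearMap.ker_eq_bot.2 (bijective_chartDifferential hq).1
  have hcomp : ![chartDifferential p q X, chartDifferential p q Y] =
      (chartDifferential (m := m) p q).toLinearMap ∘ ![X, Y] := by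
    ext1 i
    fin_cases i <;> rfl
  rw [hcomp, LinearMap.linearIndependent_iff _ hker]

section VectorValued

variable {E : Type*} [NormedAddCommGroup E] [NormedSpace ℝ E] {h : M → E}

theorem contDiffAt_comp_extChartAt_symm (hu : u ∈ (extChartAt (𝓡 m) p).target)
    (hh : ContMDiffAt (𝓡 m) 𝓘(ℝ, E) ∞ h ((extChartAt (𝓡 m) p).symm u)) :
    ContDiffAt ℝ ∞ (h ∘ (extChartAt (𝓡 m) p).symm) u :=
  contMDiffAt_iff_contDiffAt.1 <| hh.comp u <| (contMDiffOn_extChartAt_symm p).contMDiffAt <|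
    (isOpen_extChartAt_target p).mem_nhds hu

theorem differentiableAt_comp_extChartAt_symm (hq : q ∈ (extChartAt (𝓡 m) p).source)
    (hh : MDifferentiableAt (𝓡 m) 𝓘(ℝ, E) h q) :
    DifferentiableAt ℝ (h ∘ (extChartAt (𝓡 m) p).symm) (extChartAt (𝓡 m) p q) := by
  have : IsManifold (𝓡 m) 1 M := IsManifold.of_le (n := ∞) (by simp)
  refine mdifferentiableAt_iff_differentiableAt.1 (MDifferentiableAt.comp _ (I' := 𝓡 m) ?_ ?_)
  · rwa [(extChartAt (𝓡 m) p).left_inv hq]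
  · exact (mdifferentiableOn_extChartAt_symm.mdifferentiableAt
      ((isOpen_extChartAt_target p).mem_nhds ((extChartAt (𝓡 m) p).map_source hq)))

theorem mfderiv_eq_fderiv_comp_chartDifferential (hq : q ∈ (extChartAt (𝓡 m) p).source)
    (hh : MDifferentiableAt (𝓡 m) 𝓘(ℝ, E) h q) :
    (mfderiv (𝓡 m) 𝓘(ℝ, E) h q : Euc m →L[ℝ] E) =
      (fderiv ℝ (h ∘ (extChartAt (𝓡 m) p).symm) (extChartAt (𝓡 m) p q)).comp
        (chartDifferential p q) := by
  have : IsManifold (𝓡 m) 1 M := IsManifold.of_le (n := ∞) (by simp)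
  have hev : h =ᶠ[𝓝 q] (h ∘ (extChartAt (𝓡 m) p).symm) ∘ extChartAt (𝓡 m) p := by
    filter_upwards [extChartAt_source_mem_nhds' hq] with x hx
    exact (congrArg h ((extChartAt (𝓡 m) p).left_inv hx)).symm
  rw [hev.mfderiv_eq, mfderiv_comp (I := 𝓡 m) (I' := 𝓘(ℝ, Euc m)) (I'' := 𝓘(ℝ, E)) q
    (differentiableAt_comp_extChartAt_symm hq hh).mdifferentiableAt
    (mdifferentiableAt_extChartAt (I := 𝓡 m) (by rwa [extChartAt_source] at hq)),
    mfderiv_eq_fderiv]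
  rfl

end VectorValued

theorem differential_apply {h : M → Euc (m + 1)} (hq : q ∈ (extChartAt (𝓡 m) p).source)
    (hh : MDifferentiableAt (𝓡 m) 𝓘(ℝ, Euc (m + 1)) h q) (X : Euc m) :
    differential h q X =
      fderiv ℝ (chartRep h p) (extChartAt (𝓡 m) p q) (chartDifferential p q X) :=
  congr($(mfderiv_eq_fderiv_comp_chartDifferential hq hh) X)

theorem eq_zero_of_injective_mfderiv_prodMk (hf : MDifferentiableAt (𝓡 m) 𝓘(ℝ, Euc (m + 1)) f p)
    (hν : MDifferentiableAt (𝓡 m) 𝓘(ℝ, Euc (m + 1)) ν p)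
    (himm : Function.Injective
      (mfderiv (𝓡 m) 𝓘(ℝ, Euc (m + 1) × Euc (m + 1)) (fun x => (f x, ν x)) p))
    {X : Euc m} (hfX : fderiv ℝ (chartRep f p) (coordAt p) X = 0)
    (hνX : fderiv ℝ (chartRep ν p) (coordAt p) X = 0) : X = 0 := by
  have hs := mem_extChartAt_source (I := 𝓡 m) p
  have hprod : fderiv ℝ ((fun x => (f x, ν x)) ∘ (extChartAt (𝓡 m) p).symm) (coordAt p) X = 0 := by
    have hderiv := (differentiableAt_comp_extChartAt_symm hs hf).fderiv_prodMk
      (differentiableAt_comp_extChartAt_symm hs hν)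
    exact congr($hderiv X).trans (Prod.ext hfX hνX)
  have hmf := congr($(mfderiv_eq_fderiv_comp_chartDifferential hs (hf.prodMk_space hν)) X)
  rw [chartDifferential_self] at hmf
  exact himm ((hmf.trans hprod).trans (map_zero _).symm)

section WaveFronts

variable (hf : ContMDiff (𝓡 m) 𝓘(ℝ, Euc (m + 1)) ∞ f)

include hf

theorem injective_fderiv_chartRep_iff (hq : q ∈ (extChartAt (𝓡 m) p).source) :
    Function.Injective (fderiv ℝ (chartRep f p) (extChartAt (𝓡 m) p q)) ↔
      q ∉ singularSet f := by
  have hcomp : ⇑(differential f q) =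
      fderiv ℝ (chartRep f p) (extChartAt (𝓡 m) p q) ∘ chartDifferential p q :=
    funext fun X => differential_apply hq ((hf q).mdifferentiableAt (by simp)) X
  rw [singularSet, mem_ofPred_eq, not_not, hcomp]
  exact (Function.Injective.of_comp_iff' _ (bijective_chartDifferential hq)).symm

namespace IsUnitNormalOn

variable (h : IsUnitNormalOn f ν V) (hV : IsOpen V)

include h hV

theorem isNormalAlong (p : M) :
    IsNormalAlong (chartRep f p) (chartRep ν p) (chartImage p V) where
  isOpen := isOpen_chartImage p hV
  smooth_map u hu := (contDiffAt_comp_extChartAt_symm hu.1 (hf _)).contDiffWithinAt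
  smooth u hu := (contDiffAt_comp_extChartAt_symm hu.1
    (h.smooth.contMDiffAt (hV.mem_nhds hu.2))).contDiffWithinAt
  norm_eq u hu := h.norm_eq _ hu.2
  normal u hu X := by
    obtain ⟨q, hq, hqV, rfl⟩ := exists_extChartAt_eq_of_mem_chartImage hu
    obtain ⟨Y, rfl⟩ := (bijective_chartDifferential hq).2 X
    rw [← differential_apply hq ((hf q).mdifferentiableAt (by simp)), chartRep,
      Function.comp_apply, (extChartAt (𝓡 m) p).left_inv hq]
    exact h.normal q hqV Y

theorem secondForm_eq_sff (hqV : q ∈ V) (hq : q ∈ (extChartAt (𝓡 m) p).source) (X Y : Euc m) :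
    secondForm f ν q X Y = sff (chartRep f p) (chartRep ν p) (extChartAt (𝓡 m) p q)
      (chartDifferential p q X) (chartDifferential p q Y) := by
  rw [sff_apply, ← differential_apply hq ((hf q).mdifferentiableAt (by simp)),
    ← differential_apply hq (h.mdifferentiableAt hV hqV)]
  rfl

theorem sectionalCurvature_eq (hqV : q ∈ V) (hq : q ∈ (extChartAt (𝓡 m) p).source)
    (hreg : q ∉ singularSet f) (X Y : Euc m) :
    sectionalCurvature f q X Y =
      pairDet (sff (chartRep f p) (chartRep ν p) (extChartAt (𝓡 m) p q))
        (chartDifferential p q X) (chartDifferential p q Y) /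
      pairDet (firstForm (chartRep f p) (extChartAt (𝓡 m) p q))
        (chartDifferential p q X) (chartDifferential p q Y) := by
  have hqs := mem_extChartAt_source (I := 𝓡 m) q
  have hsff : ∀ X Y : Euc m, sff (chartRep f q) (chartRep ν q) (extChartAt (𝓡 m) q q) X Y =
      sff (chartRep f p) (chartRep ν p) (extChartAt (𝓡 m) p q)
        (chartDifferential p q X) (chartDifferential p q Y) := fun X Y => by
    rw [← h.secondForm_eq_sff hf hV hqV hq, h.secondForm_eq_sff hf hV hqV hqs,
      chartDifferential_self]
    rfl
  have hdf : ∀ X : Euc m, fderiv ℝ (chartRep f q) (extChartAt (𝓡 m) q q) X =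
      fderiv ℝ (chartRep f p) (extChartAt (𝓡 m) p q) (chartDifferential p q X) := fun X => by
    have hfq := (hf q).mdifferentiableAt (n := ∞) (by simp)
    rw [← differential_apply hq hfq, differential_apply hqs hfq, chartDifferential_self]
    rfl
  refine ((h.isNormalAlong hf hV q).sectional_eq (extChartAt_mem_chartImage hqs hqV)
    ((injective_fderiv_chartRep_iff hf hqs).2 hreg) X Y).trans ?_
  simp only [pairDet, gramForm_apply, ContinuousLinearMap.coe_coe, hsff, hdf]

theorem hasCurvatureGE {c : ℝ}
    (hK : ∀ q ∈ U \ singularSet f, ∀ X Y : TangentSpace (𝓡 m) q,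
      LinearIndependent ℝ ![X, Y] → c ≤ sectionalCurvature f q X Y) :
    HasCurvatureGE (chartRep f p) (chartRep ν p) (chartImage p (V ∩ U)) c := by
  intro u hu hi X Y
  by_cases hXY : LinearIndependent ℝ ![X, Y]
  · obtain ⟨q, hq, ⟨hqV, hqU⟩, rfl⟩ := exists_extChartAt_eq_of_mem_chartImage hu
    obtain ⟨X, rfl⟩ := (bijective_chartDifferential hq).2 X
    obtain ⟨Y, rfl⟩ := (bijective_chartDifferential hq).2 Y
    have hreg := (injective_fderiv_chartRep_iff hf hq).1 hi
    rw [← le_div_iff₀ (pairDet_gramForm_pos hi hXY), ← h.sectionalCurvature_eq hf hV hqV hq hreg]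
    exact hK q ⟨hqU, hreg⟩ X Y ((linearIndependent_chartDifferential_iff hq X Y).1 hXY)
  · rw [pairDet_eq_zero_of_not_linearIndependent hXY,
      pairDet_eq_zero_of_not_linearIndependent hXY, mul_zero]

theorem exists_sectionalCurvature_le (hpV : p ∈ V) {C : ℝ}
    (hC : ∀ᶠ u in 𝓝 (coordAt p), ∀ X Y, |pairDet (sff (chartRep f p) (chartRep ν p) u) X Y| ≤
      C * pairDet (firstForm (chartRep f p) u) X Y) :
    ∃ S ∈ 𝓝 p, ∃ C : ℝ, ∀ q ∈ (S ∩ U) \ singularSet f, ∀ X Y : TangentSpace (𝓡 m) q,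
      LinearIndependent ℝ ![X, Y] → |sectionalCurvature f q X Y| ≤ C := by
  have hmem := inter_mem (inter_mem ((continuousAt_extChartAt (I := 𝓡 m) p).eventually hC)
    (extChartAt_source_mem_nhds (I := 𝓡 m) p)) (hV.mem_nhds hpV)
  refine ⟨_, hmem, C, ?_⟩
  rintro q ⟨⟨⟨⟨hqC, hq⟩, hqV⟩, -⟩, hreg⟩ X Y hXY
  have hpos := pairDet_gramForm_pos ((injective_fderiv_chartRep_iff hf hq).2 hreg)
    ((linearIndependent_chartDifferential_iff hq X Y).2 hXY)
  have heq := h.sectionalCurvature_eq hf hV hqV hq hreg X Y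
  rw [heq, abs_div, abs_of_pos hpos, div_le_iff₀ hpos]
  exact hqC _ _

end IsUnitNormalOn

end WaveFronts

section A2Points

variable (hf : IsWaveFront f) (hU : IsOpen U)

include hf hU

theorem IsA2Point.exists_isCuspidal (hp : IsA2Point f p) (hpU : p ∈ U) (hV : IsOpen V)
    (hpV : p ∈ V) (hν : IsUnitNormalOn f ν V) :
    ∃ Ω ⊆ chartImage p (V ∩ U), IsCuspidal (chartRep f p) (chartRep ν p) Ω (coordAt p) := by
  obtain ⟨V', ν', hV', hpV', hν', hnull⟩ := hp.exists_null
  obtain ⟨V'', ν'', hV'', hpV'', hν'', himm⟩ := hf.2 p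
  have hΩ := isOpen_chartImage (m := m) p (((hV.inter hU).inter hV').inter hV'')
  have hmem : coordAt p ∈ chartImage p (V ∩ U ∩ V' ∩ V'') :=
    extChartAt_mem_chartImage (mem_extChartAt_source (I := 𝓡 m) p) ⟨⟨⟨hpV, hpU⟩, hpV'⟩, hpV''⟩
  refine ⟨chartImage p (V ∩ U ∩ V' ∩ V''), chartImage_mono fun x hx => hx.1.1, ?_⟩
  exact ((hν.isNormalAlong hf.1 hV p).mono hΩ (chartImage_mono fun x hx => hx.1.1.1)).isCuspidal
    ((hν'.isNormalAlong hf.1 hV' p).mono hΩ (chartImage_mono fun x hx => hx.1.2))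
    ((hν''.isNormalAlong hf.1 hV'' p).mono hΩ (chartImage_mono fun x hx => hx.2)) hmem hnull
    fun X => eq_zero_of_injective_mfderiv_prodMk ((hf.1 p).mdifferentiableAt (by simp))
      (hν''.mdifferentiableAt hV'' hpV'') (himm p hpV'')

variable (hA : ∀ p ∈ U ∩ singularSet f, IsA2Point f p)

include hA

theorem secondForm_eq_zero {c : ℝ}
    (hK : ∀ q ∈ U \ singularSet f, ∀ X Y : TangentSpace (𝓡 m) q,
      LinearIndependent ℝ ![X, Y] → c ≤ sectionalCurvature f q X Y)
    (hp : p ∈ U ∩ singularSet f) (hV : IsOpen V) (hpV : p ∈ V) (hν : IsUnitNormalOn f ν V)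
    (X Y : TangentSpace (𝓡 m) p) : secondForm f ν p X Y = 0 := by
  obtain ⟨Ω, hΩ, hc⟩ := (hA p hp).exists_isCuspidal hf hU hp.1 hV hpV hν
  have hII := hc.sff_eq_zero fun v hv => hν.hasCurvatureGE hf.1 hV hK v (hΩ hv)
  refine (hν.secondForm_eq_sff hf.1 hV hpV (mem_extChartAt_source p) X Y).trans ?_
  exact congr($hII _ _)

theorem exists_sectionalCurvature_le {c : ℝ}
    (hK : ∀ q ∈ U \ singularSet f, ∀ X Y : TangentSpace (𝓡 m) q,
      LinearIndependent ℝ ![X, Y] → c ≤ sectionalCurvature f q X Y) (hp : p ∈ U) :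
    ∃ S ∈ 𝓝 p, ∃ C : ℝ, ∀ q ∈ (S ∩ U) \ singularSet f, ∀ X Y : TangentSpace (𝓡 m) q,
      LinearIndependent ℝ ![X, Y] → |sectionalCurvature f q X Y| ≤ C := by
  obtain ⟨V, ν, hV, hpV, hν, -⟩ := hf.2 p
  have hps := mem_extChartAt_source (I := 𝓡 m) p
  suffices hC : ∃ C : ℝ, ∀ᶠ u in 𝓝 (coordAt p), ∀ X Y,
      |pairDet (sff (chartRep f p) (chartRep ν p) u) X Y| ≤
        C * pairDet (firstForm (chartRep f p) u) X Y from
    hν.exists_sectionalCurvature_le hf.1 hV hpV hC.choose_spec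
  by_cases hsing : p ∈ singularSet f
  · obtain ⟨Ω, hΩ, hc⟩ := (hA p ⟨hp, hsing⟩).exists_isCuspidal hf hU hp hV hpV hν
    refine hc.exists_abs_pairDet_sff_le fun v hv hv₀ => LinearMap.ext₂ fun X Y => ?_
    have hinj := mt (hc.isNormal.jacobian_ne_zero_iff hv).2 (not_not.2 hv₀)
    obtain ⟨q, hq, ⟨hqV, hqU⟩, rfl⟩ := exists_extChartAt_eq_of_mem_chartImage (hΩ hv)
    rw [injective_fderiv_chartRep_iff hf.1 hq, not_not] at hinj
    obtain ⟨X, rfl⟩ := (bijective_chartDifferential hq).2 X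
    obtain ⟨Y, rfl⟩ := (bijective_chartDifferential hq).2 Y
    rw [← hν.secondForm_eq_sff hf.1 hV hqV hq]
    exact secondForm_eq_zero hf hU hA hK ⟨hqU, hinj⟩ hV hqV hν X Y
  · exact (hν.isNormalAlong hf.1 hV p).exists_abs_pairDet_sff_le_of_injective
      (extChartAt_mem_chartImage hps hpV) ((injective_fderiv_chartRep_iff hf.1 hps).2 hsing)

theorem IsSingularPrincipalCurvature.nonpos
    (hK : ∀ q ∈ U \ singularSet f, ∀ X Y : TangentSpace (𝓡 m) q,
      LinearIndependent ℝ ![X, Y] → 0 ≤ sectionalCurvature f q X Y)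
    (hp : p ∈ U ∩ singularSet f) {κ : ℝ} (hκ : IsSingularPrincipalCurvature f p κ) : κ ≤ 0 := by
  obtain ⟨V, ν, hV, hpV, hν, W, hW, hpW, -, S, hS, hκ⟩ := hκ
  obtain ⟨Ω, hΩ, hc⟩ := (hA p hp).exists_isCuspidal hf hU hp.1 hV hpV hν
  exact hc.hasEigenvalue_nonpos (fun v hv => hν.hasCurvatureGE hf.1 hV hK v (hΩ hv))
    (hW.mem_nhds hpW) hS hκ

end A2Points

end Charts

end WaveFront

theorem mainTheorem2_general {m : ℕ} {M : Type*} [TopologicalSpace M]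
    [ChartedSpace (EuclideanSpace ℝ (Fin m)) M] [IsManifold (𝓡 m) ∞ M]
    (f : M → EuclideanSpace ℝ (Fin (m + 1))) (hf : WaveFront.IsWaveFront f)
    (U : Set M) (hU : IsOpen U)
    (hA : ∀ p ∈ U ∩ WaveFront.singularSet f, WaveFront.IsA2Point f p) :
    ((∃ c : ℝ, ∀ q ∈ U \ WaveFront.singularSet f, ∀ X Y : TangentSpace (𝓡 m) q,
        LinearIndependent ℝ ![X, Y] → c ≤ WaveFront.sectionalCurvature f q X Y) →
      (∀ p ∈ U ∩ WaveFront.singularSet f,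
        ∀ (V : Set M) (ν : M → EuclideanSpace ℝ (Fin (m + 1))),
          IsOpen V → p ∈ V → WaveFront.IsUnitNormalOn f ν V →
          ∀ X Y : TangentSpace (𝓡 m) p, WaveFront.secondForm f ν p X Y = 0) ∧
      ∀ p ∈ U, ∃ V ∈ 𝓝 p, ∃ C : ℝ, ∀ q ∈ (V ∩ U) \ WaveFront.singularSet f,
        ∀ X Y : TangentSpace (𝓡 m) q,
          LinearIndependent ℝ ![X, Y] → |WaveFront.sectionalCurvature f q X Y| ≤ C) ∧
    ((∀ q ∈ U \ WaveFront.singularSet f, ∀ X Y : TangentSpace (𝓡 m) q,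
        LinearIndependent ℝ ![X, Y] → 0 ≤ WaveFront.sectionalCurvature f q X Y) →
      ∀ p ∈ U ∩ WaveFront.singularSet f, ∀ κ : ℝ,
        WaveFront.IsSingularPrincipalCurvature f p κ → κ ≤ 0) := by
  refine ⟨?_, fun hK p hp κ hκ => hκ.nonpos hf hU hA hK hp⟩
  rintro ⟨c, hK⟩
  exact ⟨fun p hp V ν hV hpV hν => WaveFront.secondForm_eq_zero hf hU hA hK hp hV hpV hν,
    fun p hp => WaveFront.exists_sectionalCurvature_le hf hU hA hK hp⟩

theorem mainTheorem2 {m : ℕ} {M : Type*} [TopologicalSpace M]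
    [ChartedSpace (EuclideanSpace ℝ (Fin m)) M] [IsManifold (𝓡 m) ∞ M]
    (f : M → EuclideanSpace ℝ (Fin (m + 1))) (hf : WaveFront.IsWaveFront f)
    (U : Set M) (hU : IsOpen U)
    (hA : ∀ p ∈ U ∩ WaveFront.singularSet f, WaveFront.IsA2Point f p) :
    ((∃ C : ℝ, ∀ q ∈ U \ WaveFront.singularSet f, ∀ X Y : TangentSpace (𝓡 m) q,
        LinearIndependent ℝ ![X, Y] → |WaveFront.sectionalCurvature f q X Y| ≤ C) →
      ∀ p ∈ U ∩ WaveFront.singularSet f, ∀ (V : Set M) (ν : M → EuclideanSpace ℝ (Fin (m + 1))),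
        IsOpen V → p ∈ V → WaveFront.IsUnitNormalOn f ν V →
        ∀ X Y : TangentSpace (𝓡 m) p, WaveFront.secondForm f ν p X Y = 0) ∧
    ((∀ q ∈ U \ WaveFront.singularSet f, ∀ X Y : TangentSpace (𝓡 m) q,
        LinearIndependent ℝ ![X, Y] → 0 ≤ WaveFront.sectionalCurvature f q X Y) →
      (∀ p ∈ U, ∃ V ∈ 𝓝 p, ∃ C : ℝ, ∀ q ∈ (V ∩ U) \ WaveFront.singularSet f,
        ∀ X Y : TangentSpace (𝓡 m) q,
          LinearIndependent ℝ ![X, Y] → |WaveFront.sectionalCurvature f q X Y| ≤ C) ∧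
      ∀ p ∈ U ∩ WaveFront.singularSet f, ∀ κ : ℝ,
        WaveFront.IsSingularPrincipalCurvature f p κ → κ ≤ 0) := by
  obtain ⟨hbelow, hnonneg⟩ := mainTheorem2_general f hf U hU hA
  exact ⟨fun ⟨C, hC⟩ => (hbelow ⟨-C, fun q hq X Y hXY => (abs_le.1 (hC q hq X Y hXY)).1⟩).1,
    fun hK => ⟨(hbelow ⟨0, hK⟩).2, hnonneg hK⟩⟩
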